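/- Let $N\ge 1$ and consider $\mathbf R^{2N-1}$ with coordinates $(a_1,\dots,a_{N-1},b_1,\dots,b_N)$ (put $a_0=a_N=0$). Let $L$ be the symmetric tridiagonal $N\times N$ matrix with diagonal $b_1,\dots,b_N$ and off-diagonal entries $a_1,\dots,a_{N-1}$, and let $H_i=\frac1i\operatorname{Tr}L^i$ for $i\ge1$. A contravariant antisymmetric $2$-tensor $\pi$ defines the bracket $\{f,g\}=\sum_{i,j}\pi_{ij}\,\partial_if\,\partial_jg$. A function $f$, smooth on an open set $U$, is a Casimir of $\pi$ on $U$ if $\{f,g\}=0$ on $U$ for all $g\in C^\infty(U)$. A smooth $2$-tensor is called trivial if every $H_i$ is a Casimir for it, and two $2$-tensors are equivalent if their difference is trivial. Define the vector fields $X_k$, $k\ge -1$, as follows. $X_{-1}=\sum_i\partial/\partial b_i$. $X_0$ is the Euler vector field. $X_1$ is given by $\dot L=[B,L]+L^2$, where $B$ is the skew-symmetric tridiagonal matrix with $B_{i,i+1}=(i+1)a_i$. $X_2$ is given by $\dot L=[B,L]+L^3$, where $B$ is the skew-symmetric pentadiagonal matrix with $B_{i,i+1}=a_i\bigl(i(b_i+b_{i+1})+b_1+\dots+b_{i-1}\bigr)$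 and $B_{i,i+2}=i\,a_ia_{i+1}$. For $k\ge3$, $(k-2)X_k=[X_1,X_{k-1}]$. The Toda brackets $\pi_n$, $n\ge1$, are the $2$-tensors, each considered up to equivalence, generated from the Lie--Poisson bracket $\pi_1$, given by $\{a_i,b_i\}=-a_i$, $\{a_i,b_{i+1}\}=a_i$ (all other brackets of coordinates zero), by means of $$L_{X_k}\pi_m=(m-k-2)\,\pi_{m+k}\qquad (m\ge1,\ k\ge-1,\ m+k\ge1,\ m\ne k+2).$$ They include as $\pi_2$ the quadratic bracket $\{a_i,a_{i+1}\}=\frac12a_ia_{i+1}$, $\{a_i,b_i\}=-a_ib_i$, $\{a_i,b_{i+1}\}=a_ib_{i+1}$, $\{b_i,b_{i+1}\}=2a_i^2$, and as $\pi_3$ the cubic bracket $\{a_i,a_{i+1}\}=a_ia_{i+1}b_{i+1}$, $\{a_i,b_i\}=-a_ib_i^2-a_i^3$, $\{a_i,b_{i+1}\}=a_ib_{i+1}^2+a_i^3$, $\{a_i,b_{i+2}\}=a_ia_{i+1}^2$, $\{a_{i+1},b_i\}=-a_i^2a_{i+1}$, $\{b_i,b_{i+1}\}=2a_i^2(b_i+b_{i+1})$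 (all other brackets of coordinates zero). Then, for every $n>2$ and every Toda bracket $\pi_n$, the set $U=\{\det L\ne0\}$ is open and dense in $\mathbf R^{2N-1}$, the function $\operatorname{Tr}L^{2-n}$ is smooth on $U$, and it is a Casimir of $\pi_n$ on $U$. -/

import Mathlib

open scoped ContDiff

noncomputable section

namespace Toda

/-! ### Vector fields, bivectors and brackets in coordinates -/

section Coordinates

variable {ι : Type*} [Fintype ι] [DecidableEq ι]

/-- The partial derivative of `f` at `x` in the direction of the coordinate `i`. -/
def pderiv (i : ι) (f : (ι → ℝ) → ℝ) (x : ι → ℝ) : ℝ :=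
  fderiv ℝ f x (Pi.single i 1)

/-- The bracket of two functions given by a contravariant 2-tensor `π`, written as its
coefficient matrix `π x i j = {x_i, x_j}(x)`. -/
def bracket (π : (ι → ℝ) → Matrix ι ι ℝ) (f g : (ι → ℝ) → ℝ) (x : ι → ℝ) : ℝ :=
  ∑ i, ∑ j, π x i j * pderiv i f x * pderiv j g x

/-- `f` is a Casimir of `π` on the open set `U`: it is a smooth function on `U` which commutes
with every smooth function on `U`. -/
def IsCasimirOn (π : (ι → ℝ) → Matrix ι ι ℝ) (U : Set (ι → ℝ)) (f : (ι → ℝ) → ℝ) : Prop :=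
  ContDiffOn ℝ ∞ f U ∧
    ∀ g : (ι → ℝ) → ℝ, ContDiffOn ℝ ∞ g U → ∀ x ∈ U, bracket π f g x = 0

/-- The Lie derivative `L_X π` of a contravariant 2-tensor along a vector field:
`(L_X π)^{ij} = X(π^{ij}) - ∑ k, π^{kj} ∂_k X^i - ∑ k, π^{ik} ∂_k X^j`. -/
def lieDerivative (X : (ι → ℝ) → (ι → ℝ)) (π : (ι → ℝ) → Matrix ι ι ℝ) :
    (ι → ℝ) → Matrix ι ι ℝ :=
  fun x => Matrix.of fun i j =>
    (∑ k, X x k * pderiv k (fun y => π y i j) x)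
      - (∑ k, π x k j * pderiv k (fun y => X y i) x)
      - ∑ k, π x i k * pderiv k (fun y => X y j) x

/-- The skew-symmetric matrix `u - uᵀ`; if `u p q` and `u q p` are not both listed as nonzero,
its entry at `(p, q)` is the listed one, `u p q`. -/
def skew (u : ι → ι → ℝ) : Matrix ι ι ℝ := Matrix.of fun p q => u p q - u q p

end Coordinates

/-! ### The phase space and the Jacobi matrix

The coordinates on `ℝ^{2N-1}` are `a_1, …, a_{N-1}, b_1, …, b_N`. In the code the indices start
at `0`: `Sum.inl i` is `a_{i+1}` and `Sum.inr i` is `b_{i+1}`. -/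

/-- The index set of the coordinates. -/
abbrev Index (N : ℕ) : Type := Fin (N - 1) ⊕ Fin N

/-- The phase space `ℝ^{2N-1}`. -/
abbrev Space (N : ℕ) : Type := Index N → ℝ

variable {N : ℕ}

/-- The coordinate `a_{k+1}`, with the convention that it is `0` when out of range. -/
def a (x : Space N) (k : ℕ) : ℝ := if h : k < N - 1 then x (Sum.inl ⟨k, h⟩) else 0

/-- The coordinate `b_{k+1}`, with the convention that it is `0` when out of range. -/
def b (x : Space N) (k : ℕ) : ℝ := if h : k < N then x (Sum.inr ⟨k, h⟩) else 0

/-- The symmetric tridiagonal (Jacobi) matrix `L`, with diagonal `b_1, …, b_N` and off-diagonal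
`a_1, …, a_{N-1}`. -/
def lax (x : Space N) : Matrix (Fin N) (Fin N) ℝ :=
  Matrix.of fun i j =>
    if (i : ℕ) = j then b x i
    else if (j : ℕ) = i + 1 then a x i
    else if (i : ℕ) = j + 1 then a x j
    else 0

/-- The functions `H_i = (1 / i) Tr L ^ i` (used for `i ≥ 1`). -/
def hamiltonian (i : ℕ) (x : Space N) : ℝ := (i : ℝ)⁻¹ * (lax x ^ i).trace

/-! ### The linear, quadratic and cubic brackets -/

/-- The Lie-Poisson bracket `π_1`: `{a_i, b_i} = -a_i`, `{a_i, b_{i+1}} = a_i`. -/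
def linearBracket (x : Space N) : Matrix (Index N) (Index N) ℝ :=
  skew fun p q => match p, q with
    | Sum.inl i, Sum.inr j =>
        if (j : ℕ) = i then -a x i
        else if (j : ℕ) = i + 1 then a x i
        else 0
    | _, _ => 0

/-- The quadratic bracket `π_2`: `{a_i, a_{i+1}} = a_i a_{i+1} / 2`, `{a_i, b_i} = -a_i b_i`,
`{a_i, b_{i+1}} = a_i b_{i+1}`, `{b_i, b_{i+1}} = 2 a_i ^ 2`. -/
def quadraticBracket (x : Space N) : Matrix (Index N) (Index N) ℝ :=
  skew fun p q => match p, q with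
    | Sum.inl i, Sum.inl j =>
        if (j : ℕ) = i + 1 then 1 / 2 * a x i * a x j else 0
    | Sum.inl i, Sum.inr j =>
        if (j : ℕ) = i then -(a x i * b x j)
        else if (j : ℕ) = i + 1 then a x i * b x j
        else 0
    | Sum.inr i, Sum.inr j =>
        if (j : ℕ) = i + 1 then 2 * a x i ^ 2 else 0
    | Sum.inr _, Sum.inl _ => 0

/-- The cubic bracket `π_3`: `{a_i, a_{i+1}} = a_i a_{i+1} b_{i+1}`,
`{a_i, b_i} = -a_i b_i ^ 2 - a_i ^ 3`, `{a_i, b_{i+1}} = a_i b_{i+1} ^ 2 + a_i ^ 3`,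
`{a_i, b_{i+2}} = a_i a_{i+1} ^ 2`, `{a_{i+1}, b_i} = -a_i ^ 2 a_{i+1}`,
`{b_i, b_{i+1}} = 2 a_i ^ 2 (b_i + b_{i+1})`. -/
def cubicBracket (x : Space N) : Matrix (Index N) (Index N) ℝ :=
  skew fun p q => match p, q with
    | Sum.inl i, Sum.inl j =>
        if (j : ℕ) = i + 1 then a x i * a x j * b x j else 0
    | Sum.inl i, Sum.inr j =>
        if (j : ℕ) = i then -(a x i * b x j ^ 2) - a x i ^ 3
        else if (j : ℕ) = i + 1 then a x i * b x j ^ 2 + a x i ^ 3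
        else if (j : ℕ) = i + 2 then a x i * a x (i + 1) ^ 2
        else if (i : ℕ) = j + 1 then -(a x j ^ 2 * a x i)
        else 0
    | Sum.inr i, Sum.inr j =>
        if (j : ℕ) = i + 1 then 2 * a x i ^ 2 * (b x i + b x j) else 0
    | Sum.inr _, Sum.inl _ => 0

/-! ### The master symmetries -/

/-- The vector field on the phase space given by `dL/dt = [B, L] + L ^ (k + 1)`, for a matrix
valued function `B` which makes the right-hand side symmetric and tridiagonal: the `a`- and
`b`-components are the off-diagonal and the diagonal entries of the right-hand side. -/
def laxField (B : Space N → Matrix (Fin N) (Fin N) ℝ) (k : ℕ) (x : Space N) : Space N :=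
  fun p => match p with
    | Sum.inl i =>
        (B x * lax x - lax x * B x + lax x ^ (k + 1)) ⟨i, by omega⟩ ⟨i + 1, by omega⟩
    | Sum.inr i => (B x * lax x - lax x * B x + lax x ^ (k + 1)) i i

/-- The tridiagonal skew-symmetric matrix `B` for `X_1`, with entry `(n + 1) a_n` at
`(n, n + 1)`. -/
def B₁ (x : Space N) : Matrix (Fin N) (Fin N) ℝ :=
  skew fun i j => if (j : ℕ) = i + 1 then ((i : ℝ) + 2) * a x i else 0

/-- The pentadiagonal skew-symmetric matrix `B` for `X_2`, with entries
`a_n (n (b_n + b_{n+1}) + b_1 + … + b_{n-1})` at `(n, n + 1)` and `n a_n a_{n+1}` at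
`(n, n + 2)`. -/
def B₂ (x : Space N) : Matrix (Fin N) (Fin N) ℝ :=
  skew fun i j =>
    if (j : ℕ) = i + 1 then
      a x i * (((i : ℝ) + 1) * (b x i + b x j) + ∑ k ∈ Finset.range (i : ℕ), b x k)
    else if (j : ℕ) = i + 2 then ((i : ℝ) + 1) * a x i * a x (i + 1)
    else 0

/-- The master symmetries `X_n`, `n ≥ 0`: the Euler field `X_0`, the fields `X_1` and `X_2`
obtained from `dL/dt = [B, L] + L ^ 2` and `dL/dt = [B, L] + L ^ 3`, and
`X_n = [X_1, X_{n-1}] / (n - 2)` for `n ≥ 3`. -/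
def masterSymmetry : ℕ → Space N → Space N
  | 0 => fun x => x
  | 1 => laxField B₁ 1
  | 2 => laxField B₂ 2
  | n + 3 => ((n : ℝ) + 1)⁻¹ •
      VectorField.lieBracket ℝ (laxField B₁ 1) (masterSymmetry (n + 2))

/-- The master symmetry `X_{-1} = grad H_1 = ∑ ∂/∂b_i`. -/
def translationField (_ : Space N) : Space N :=
  fun p => match p with
    | Sum.inl _ => 0
    | Sum.inr _ => 1

/-! ### The hierarchy -/

/-- A smooth 2-tensor is trivial if all the `H_i` are Casimirs for it. -/
structure IsTrivial (τ : Space N → Matrix (Index N) (Index N) ℝ) : Prop where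
  smooth : ∀ p q, ContDiff ℝ ∞ fun x => τ x p q
  skew_symm : ∀ x p q, τ x p q = -τ x q p
  casimir : ∀ i : ℕ, 1 ≤ i → IsCasimirOn τ Set.univ (hamiltonian i)

/-- `IsTodaBracket n π` says that `π` is an `n`-th Toda bracket `π_n`, i.e. that it is generated
from `π_1` by the master symmetries through `L_{X_k} π_m = (m - k - 2) π_{m+k}`, `k ≥ -1`, where
the `π_n` only matter up to equivalence, i.e. up to adding a trivial 2-tensor. -/
inductive IsTodaBracket : ℕ → (Space N → Matrix (Index N) (Index N) ℝ) → Prop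
  | linear : IsTodaBracket 1 linearBracket
  | quadratic : IsTodaBracket 2 quadraticBracket
  | cubic : IsTodaBracket 3 cubicBracket
  | raise {m : ℕ} {π : Space N → Matrix (Index N) (Index N) ℝ} (k : ℕ) (hk : m ≠ k + 2)
      (h : IsTodaBracket m π) :
      IsTodaBracket (m + k) (((m : ℝ) - k - 2)⁻¹ • lieDerivative (masterSymmetry k) π)
  | lower {m : ℕ} {π : Space N → Matrix (Index N) (Index N) ℝ} (hm : 1 ≤ m)
      (h : IsTodaBracket (m + 1) π) :
      IsTodaBracket m ((m : ℝ)⁻¹ • lieDerivative translationField π)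
  | equiv {m : ℕ} {π τ : Space N → Matrix (Index N) (Index N) ℝ}
      (h : IsTodaBracket m π) (hτ : IsTrivial τ) : IsTodaBracket m (π + τ)

end Toda

end

noncomputable section

namespace Toda

/-! Write `T = lower M` for the lower triangular matrix with `M = (T + Tᵀ) / 2`, and let `χ_m` be
the vector field `dL/dt = [T, L]` with `M = L ^ m`. The key is the Lenard relations: `π_n` sends `d
Tr L ^ j` to `j χ_{j+n-2}`, that is, `π_n dH_j = π_1 dH_{j+n-1}`.

For `π_1`, `π_2`, `π_3` they are checked entry by entry, using that `M = L ^ m` is symmetric and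
commutes with `L` (`linearBracket_apply`, `quadraticBracket_apply`, `cubicBracket_apply`). They then
propagate along the hierarchy. With `e = k + 1`, the field `X_k` satisfies `X_k (Tr L ^ m) = m Tr L
^ (m+e-1)` and `[X_k, χ_m] = m χ_{m+e-1}` (`IsMasterSymmetry`). The Leibniz rule `(L_X π) df = [X, π
df] - π d(X f)` turns these two facts into the relations for `π_{m+k}`, with exactly the factor `m -
k - 2` of the definition (`HasLenardRelations.lieDerivative`). Trivial tensors kill every `dH_j`, so
passing to an equivalent tensor changes nothing.

Negative powers are reached pointwise. At a fixed `x` the relations say that `π_n` maps the covector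
`gradTrace M` to `flow x (M L ^ (n-1))` for `M` a power of `L`; both sides are linear in `M`, so
this holds for every polynomial in `L`. When `det L ≠ 0`, Cayley-Hamilton makes `L⁻¹` such a
polynomial. The differential of `Tr L ^ (2-n)` is a multiple of `gradTrace (L ^ (1-n))`, which is
therefore sent to the flow of `L ^ (1-n) L ^ (n-1) = 1`, namely `[1, L] = 0`. -/

theorem two_le_infty : (2 : WithTop ℕ∞) ≤ ∞ :=
  WithTop.coe_le_coe.2 (le_top : (2 : ℕ∞) ≤ ⊤)

/-! ### The anchor map of a contravariant 2-tensor -/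

section Anchor

variable {ι : Type*} [Fintype ι] [DecidableEq ι]

/-- The vector field `{f, ·}` of a function with respect to a contravariant 2-tensor. -/
def sharp (π : (ι → ℝ) → Matrix ι ι ℝ) (f : (ι → ℝ) → ℝ) (x : ι → ℝ) : ι → ℝ :=
  fun j => ∑ i, π x i j * pderiv i f x

theorem fderiv_eq_sum_pderiv (f : (ι → ℝ) → ℝ) (x v : ι → ℝ) :
    fderiv ℝ f x v = ∑ k, v k * pderiv k f x := by
  conv_lhs => rw [pi_eq_sum_univ' v, map_sum]
  refine Finset.sum_congr rfl fun k _ => ?_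
  rw [map_smul, smul_eq_mul, pderiv]

omit [DecidableEq ι] in
theorem fderiv_component {V : (ι → ℝ) → (ι → ℝ)} {x : ι → ℝ} (hV : DifferentiableAt ℝ V x)
    (v : ι → ℝ) (j : ι) : fderiv ℝ V x v j = fderiv ℝ (fun y => V y j) x v := by
  rw [fderiv_apply hV j]
  simp

theorem contDiff_pderiv {f : (ι → ℝ) → ℝ} (hf : ContDiff ℝ ∞ f) (i : ι) :
    ContDiff ℝ ∞ (pderiv i f) := by
  unfold pderiv
  exact (hf.fderiv_right (m := ∞) (by simp)).clm_apply contDiff_const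

theorem contDiff_sharp {π : (ι → ℝ) → Matrix ι ι ℝ} (hπ : ∀ p q, ContDiff ℝ ∞ fun x => π x p q)
    {f : (ι → ℝ) → ℝ} (hf : ContDiff ℝ ∞ f) : ContDiff ℝ ∞ (sharp π f) := by
  refine contDiff_pi.2 fun j => ?_
  exact ContDiff.sum fun i _ => (hπ i j).mul (contDiff_pderiv hf i)

theorem contDiff_lieDerivative {X : (ι → ℝ) → (ι → ℝ)} (hX : ContDiff ℝ ∞ X)
    {π : (ι → ℝ) → Matrix ι ι ℝ} (hπ : ∀ p q, ContDiff ℝ ∞ fun x => π x p q) (p q : ι) :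
    ContDiff ℝ ∞ fun x => lieDerivative X π x p q := by
  have hc := contDiff_pi.1 hX
  simp only [lieDerivative, Matrix.of_apply]
  refine ((ContDiff.sum fun k _ => ?_).sub (ContDiff.sum fun k _ => ?_)).sub
    (ContDiff.sum fun k _ => ?_)
  · exact (hc k).mul (contDiff_pderiv (hπ p q) k)
  · exact (hπ k q).mul (contDiff_pderiv (hc p) k)
  · exact (hπ p k).mul (contDiff_pderiv (hc q) k)

/-- The product rule together with the symmetry of the second derivative, which moves the Hessian of
`f` onto `X`. -/
theorem pderiv_fderiv_apply {f : (ι → ℝ) → ℝ} (hf : ContDiff ℝ ∞ f) {X : (ι → ℝ) → (ι → ℝ)}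
    (hX : ContDiff ℝ ∞ X) (i : ι) (x : ι → ℝ) :
    pderiv i (fun y => fderiv ℝ f y (X y)) x =
      fderiv ℝ (pderiv i f) x (X x) + ∑ k, pderiv i (fun y => X y k) x * pderiv k f x := by
  have hdf : DifferentiableAt ℝ (fderiv ℝ f) x :=
    ((hf.fderiv_right (m := ∞) (by simp)).differentiable (by simp)) x
  have hdX : DifferentiableAt ℝ X x := (hX.differentiable (by simp)) x
  have hs : IsSymmSndFDerivAt ℝ f x :=
    hf.contDiffAt.isSymmSndFDerivAt (by simpa using two_le_infty)
  have h1 : fderiv ℝ (pderiv i f) x (X x) = fderiv ℝ (fderiv ℝ f) x (X x) (Pi.single i 1) := by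
    unfold pderiv
    rw [fderiv_clm_apply hdf (by fun_prop)]
    simp
  rw [h1, hs.eq, pderiv, fderiv_clm_apply hdf hdX]
  simp only [add_apply, ContinuousLinearMap.comp_apply,
    ContinuousLinearMap.flip_apply]
  rw [fderiv_eq_sum_pderiv f, add_comm]
  congr 1
  refine Finset.sum_congr rfl fun k _ => ?_
  rw [fderiv_component hdX]
  rfl

/-- The Leibniz rule for `L_X` applied to the contraction of `π` with `df`, using `L_X df = d(X f)`.
In coordinates the Hessian terms of `f` cancel, and the rest agrees after renaming summation
indices. -/
theorem sharp_lieDerivative {X : (ι → ℝ) → (ι → ℝ)} (hX : ContDiff ℝ ∞ X)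
    {π : (ι → ℝ) → Matrix ι ι ℝ} (hπ : ∀ p q, ContDiff ℝ ∞ fun x => π x p q)
    {f : (ι → ℝ) → ℝ} (hf : ContDiff ℝ ∞ f) :
    sharp (lieDerivative X π) f =
      VectorField.lieBracket ℝ X (sharp π f) - sharp π (fun y => fderiv ℝ f y (X y)) := by
  funext x j
  have hdX : DifferentiableAt ℝ X x := (hX.differentiable (by simp)) x
  have hds : DifferentiableAt ℝ (sharp π f) x :=
    ((contDiff_sharp hπ hf).differentiable (by simp)) x
  have hV : fderiv ℝ (fun y => sharp π f y j) x (X x) =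
      ∑ i, (fderiv ℝ (fun y => π y i j) x (X x) * pderiv i f x +
        π x i j * fderiv ℝ (pderiv i f) x (X x)) := by
    unfold sharp
    rw [fderiv_fun_sum fun i _ => ((hπ i j).mul (contDiff_pderiv hf i)).differentiable (by simp) x]
    rw [sum_apply]
    refine Finset.sum_congr rfl fun i _ => ?_
    rw [fderiv_fun_mul ((hπ i j).differentiable (by simp) x)
      ((contDiff_pderiv hf i).differentiable (by simp) x)]
    simp only [add_apply, smul_apply, smul_eq_mul]
    ring
  rw [Pi.sub_apply, Pi.sub_apply, VectorField.lieBracket, Pi.sub_apply,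
    fderiv_component hds, fderiv_component hdX, hV, fderiv_eq_sum_pderiv (fun y => X y j)]
  simp only [sharp, lieDerivative, Matrix.of_apply, pderiv_fderiv_apply hf hX,
    fun i => fderiv_eq_sum_pderiv (fun y => π y i j) x (X x)]
  simp only [sub_mul, mul_add, Finset.sum_sub_distrib, Finset.sum_add_distrib, Finset.sum_mul,
    Finset.mul_sum]
  have e1 : ∑ i, ∑ k, π x k j * pderiv k (fun y => X y i) x * pderiv i f x =
      ∑ i, ∑ k, π x i j * (pderiv i (fun y => X y k) x * pderiv k f x) := by
    rw [Finset.sum_comm]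
    exact Finset.sum_congr rfl fun _ _ => Finset.sum_congr rfl fun _ _ => by ring
  have e2 : ∑ i, ∑ k, π x i k * pderiv k (fun y => X y j) x * pderiv i f x =
      ∑ k, ∑ i, π x i k * pderiv i f x * pderiv k (fun y => X y j) x := by
    rw [Finset.sum_comm]
    exact Finset.sum_congr rfl fun _ _ => Finset.sum_congr rfl fun _ _ => by ring
  rw [e1, e2]
  ring

theorem bracket_eq_sum_sharp (π : (ι → ℝ) → Matrix ι ι ℝ) (f g : (ι → ℝ) → ℝ) (x : ι → ℝ) :
    bracket π f g x = ∑ j, sharp π f x j * pderiv j g x := by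
  simp only [bracket, sharp, Finset.sum_mul]
  exact Finset.sum_comm

/-- Testing against the coordinate functions reads off each component of `{f, ·}`. -/
theorem IsCasimirOn.sharp_eq_zero {π : (ι → ℝ) → Matrix ι ι ℝ} {f : (ι → ℝ) → ℝ}
    (h : IsCasimirOn π Set.univ f) : sharp π f = 0 := by
  funext x j
  have h1 := h.2 (fun y => y j) (by fun_prop) x (Set.mem_univ x)
  rw [bracket_eq_sum_sharp, Finset.sum_eq_single j] at h1
  · have : pderiv j (fun y : ι → ℝ => y j) x = 1 := by
      rw [pderiv, (hasFDerivAt_apply j x).fderiv]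
      simp
    simpa [this] using h1
  · intro i _ hij
    have : pderiv i (fun y : ι → ℝ => y j) x = 0 := by
      rw [pderiv, (hasFDerivAt_apply j x).fderiv]
      simp [hij.symm]
    simp [this]
  · simp

theorem sharp_add_tensor (π τ : (ι → ℝ) → Matrix ι ι ℝ) (f : (ι → ℝ) → ℝ) :
    sharp (π + τ) f = sharp π f + sharp τ f := by
  funext x j
  simp [sharp, add_mul, Finset.sum_add_distrib]

theorem sharp_smul_tensor (c : ℝ) (π : (ι → ℝ) → Matrix ι ι ℝ) (f : (ι → ℝ) → ℝ) :
    sharp (c • π) f = c • sharp π f := by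
  funext x j
  simp [sharp, Finset.mul_sum, mul_assoc]

theorem sharp_const_mul (π : (ι → ℝ) → Matrix ι ι ℝ) (c : ℝ) {f : (ι → ℝ) → ℝ}
    (hf : ContDiff ℝ ∞ f) : sharp π (fun x => c * f x) = c • sharp π f := by
  funext x j
  simp only [sharp, Pi.smul_apply, smul_eq_mul, Finset.mul_sum, pderiv]
  refine Finset.sum_congr rfl fun i _ => ?_
  rw [fderiv_const_mul (hf.differentiable (by simp) x)]
  simp only [smul_apply, smul_eq_mul]
  ring

end Anchor

/-! ### Matrices as doubly infinite arrays

Extending by zero makes the band structure of the matrices uniform up to the boundary. -/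

section Entries

variable {N : ℕ}

/-- The entries of a matrix, extended by zero to all pairs of integers. -/
def ent (M : Matrix (Fin N) (Fin N) ℝ) (i j : ℤ) : ℝ :=
  if h : (0 ≤ i ∧ i < N) ∧ 0 ≤ j ∧ j < N then
    M ⟨i.toNat, by omega⟩ ⟨j.toNat, by omega⟩ else 0

/-- The coordinate `a`, extended by zero to all integers. -/
def al (x : Space N) (i : ℤ) : ℝ := if 0 ≤ i then a x i.toNat else 0

/-- The coordinate `b`, extended by zero to all integers. -/
def be (x : Space N) (i : ℤ) : ℝ := if 0 ≤ i then b x i.toNat else 0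

/-- The sum of the `b_k` with `k < i`. -/
def partialSum (x : Space N) (i : ℤ) : ℝ := ∑ k ∈ Finset.range i.toNat, b x k

theorem ent_coe (M : Matrix (Fin N) (Fin N) ℝ) (i j : Fin N) : ent M (i : ℕ) (j : ℕ) = M i j := by
  have := i.2
  have := j.2
  rw [ent, dif_pos (by omega)]
  rfl

theorem ent_ext {M W : Matrix (Fin N) (Fin N) ℝ} (h : ∀ i j, ent M i j = ent W i j) : M = W := by
  ext i j
  simpa only [ent_coe] using h i j

theorem ent_eq_zero_of_row {M : Matrix (Fin N) (Fin N) ℝ} {i : ℤ} (j : ℤ)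
    (h : ¬ (0 ≤ i ∧ i < N)) : ent M i j = 0 := by
  rw [ent, dif_neg (by tauto)]

theorem ent_eq_zero_of_col {M : Matrix (Fin N) (Fin N) ℝ} (i : ℤ) {j : ℤ}
    (h : ¬ (0 ≤ j ∧ j < N)) : ent M i j = 0 := by
  rw [ent, dif_neg (by tauto)]

theorem al_coe (x : Space N) (i : ℕ) : al x i = a x i := by simp [al]

theorem be_coe (x : Space N) (i : ℕ) : be x i = b x i := by simp [be]

theorem a_coe (x : Space N) (i : Fin (N - 1)) : a x i = x (Sum.inl i) := by simp [a]

theorem b_coe (x : Space N) (i : Fin N) : b x i = x (Sum.inr i) := by simp [b]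

theorem al_eq_zero (x : Space N) {i : ℤ} (h : ¬ (0 ≤ i ∧ i + 1 < N)) : al x i = 0 := by
  by_cases h0 : 0 ≤ i
  · rw [al, if_pos h0, a, dif_neg (by omega)]
  · rw [al, if_neg h0]

theorem be_eq_zero (x : Space N) {i : ℤ} (h : ¬ (0 ≤ i ∧ i < N)) : be x i = 0 := by
  by_cases h0 : 0 ≤ i
  · rw [be, if_pos h0, b, dif_neg (by omega)]
  · rw [be, if_neg h0]

theorem partialSum_succ (x : Space N) (i : ℤ) :
    partialSum x (i + 1) = partialSum x i + be x i := by
  by_cases h0 : 0 ≤ i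
  · rw [partialSum, partialSum, be, if_pos h0, Int.toNat_add h0 (by norm_num)]
    exact Finset.sum_range_succ _ _
  · rw [partialSum, partialSum, be, if_neg h0, Int.toNat_of_nonpos (by omega),
      Int.toNat_of_nonpos (by omega)]
    simp

theorem ent_zero (i j : ℤ) : ent (0 : Matrix (Fin N) (Fin N) ℝ) i j = 0 := by
  simp [ent]

theorem ent_add (M W : Matrix (Fin N) (Fin N) ℝ) (i j : ℤ) :
    ent (M + W) i j = ent M i j + ent W i j := by
  unfold ent; split_ifs <;> simp

theorem ent_sub (M W : Matrix (Fin N) (Fin N) ℝ) (i j : ℤ) :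
    ent (M - W) i j = ent M i j - ent W i j := by
  unfold ent; split_ifs <;> simp

theorem ent_smul (c : ℝ) (M : Matrix (Fin N) (Fin N) ℝ) (i j : ℤ) :
    ent (c • M) i j = c * ent M i j := by
  unfold ent; split_ifs <;> simp

theorem ent_transpose (M : Matrix (Fin N) (Fin N) ℝ) (i j : ℤ) :
    ent M.transpose i j = ent M j i := by
  unfold ent
  by_cases h : (0 ≤ i ∧ i < N) ∧ 0 ≤ j ∧ j < N
  · rw [dif_pos h, dif_pos h.symm]; rfl
  · rw [dif_neg h, dif_neg (fun h' => h h'.symm)]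

theorem ent_symm {M : Matrix (Fin N) (Fin N) ℝ} (hM : M.IsSymm) (i j : ℤ) :
    ent M i j = ent M j i := by
  rw [← ent_transpose, hM.eq]

theorem sum_fin_eq_sum_Ico (n : ℕ) (F : ℤ → ℝ) :
    ∑ i : Fin n, F (i : ℕ) = ∑ k ∈ Finset.Ico (0 : ℤ) n, F k := by
  rw [Fin.sum_univ_eq_sum_range (fun k => F k) n]
  refine Finset.sum_nbij (fun k : ℕ => (k : ℤ)) ?_ ?_ ?_ fun _ _ => rfl
  · intro k hk
    simp only [Finset.mem_range] at hk
    simp only [Finset.mem_Ico]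
    omega
  · intro k _ l _ h
    exact Int.ofNat_inj.1 h
  · intro k hk
    simp only [Finset.coe_Ico, Set.mem_Ico] at hk
    exact ⟨k.toNat, by simp; omega, by simp; omega⟩

/-- Both the interval and the five-term window carry the whole support of `F`, so each sum equals
the sum over their union. No case distinction at the boundary of the matrix remains. -/
theorem sum_Ico_eq_of_band (n : ℕ) (F : ℤ → ℝ) (j : ℤ)
    (h0 : ∀ k : ℤ, ¬ (0 ≤ k ∧ k < n) → F k = 0) (hF : ∀ k : ℤ, ¬ (j - 2 ≤ k ∧ k ≤ j + 2) → F k = 0) :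
    ∑ k ∈ Finset.Ico (0 : ℤ) n, F k = F (j - 2) + F (j - 1) + F j + F (j + 1) + F (j + 2) := by
  have h1 : ∑ k ∈ Finset.Ico (0 : ℤ) n, F k = ∑ k ∈ Finset.Ico 0 (n : ℤ) ∪ Finset.Icc (j - 2) (j + 2), F k :=
    Finset.sum_subset Finset.subset_union_left fun k _ hk => h0 k (by simpa using hk)
  have h2 : ∑ k ∈ Finset.Icc (j - 2) (j + 2), F k =
      ∑ k ∈ Finset.Ico 0 (n : ℤ) ∪ Finset.Icc (j - 2) (j + 2), F k :=
    Finset.sum_subset Finset.subset_union_right fun k _ hk => hF k (by simpa using hk)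
  have h3 : Finset.Icc (j - 2) (j + 2) = {j - 2, j - 1, j, j + 1, j + 2} := by
    ext k
    simp only [Finset.mem_Icc, Finset.mem_insert, Finset.mem_singleton]
    omega
  rw [h1, ← h2, h3, Finset.sum_insert, Finset.sum_insert, Finset.sum_insert, Finset.sum_insert,
    Finset.sum_singleton]
  · ring
  all_goals
    simp only [Finset.mem_insert, Finset.mem_singleton]
    omega

theorem sum_fin_eq_of_band (n : ℕ) (F : ℤ → ℝ) (j : ℤ)
    (h0 : ∀ k : ℤ, ¬ (0 ≤ k ∧ k < n) → F k = 0) (hF : ∀ k : ℤ, ¬ (j - 2 ≤ k ∧ k ≤ j + 2) → F k = 0) :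
    ∑ k : Fin n, F (k : ℕ) = F (j - 2) + F (j - 1) + F j + F (j + 1) + F (j + 2) := by
  rw [sum_fin_eq_sum_Ico, sum_Ico_eq_of_band n F j h0 hF]

theorem ent_mul (M W : Matrix (Fin N) (Fin N) ℝ) (i j : ℤ) :
    ent (M * W) i j = ∑ k ∈ Finset.Ico (0 : ℤ) N, ent M i k * ent W k j := by
  by_cases hi : 0 ≤ i ∧ i < N
  · by_cases hj : 0 ≤ j ∧ j < N
    · lift i to ℕ using hi.1
      lift j to ℕ using hj.1
      rw [← sum_fin_eq_sum_Ico N (fun k => ent M i k * ent W k j)]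
      have h1 := ent_coe (M * W) ⟨i, by omega⟩ ⟨j, by omega⟩
      rw [Matrix.mul_apply] at h1
      refine h1.trans (Finset.sum_congr rfl fun k _ => ?_)
      simp only [← ent_coe]
    · simp [ent_eq_zero_of_col _ hj]
  · simp [ent_eq_zero_of_row _ hi]

/-- The matrix vanishes outside the five central diagonals. -/
def IsBanded (W : Matrix (Fin N) (Fin N) ℝ) : Prop :=
  ∀ i j, ¬ (j - 2 ≤ i ∧ i ≤ j + 2) → ent W i j = 0

theorem ent_mul_of_banded (M : Matrix (Fin N) (Fin N) ℝ) {W : Matrix (Fin N) (Fin N) ℝ}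
    (hW : IsBanded W) (i j : ℤ) :
    ent (M * W) i j = ent M i (j - 2) * ent W (j - 2) j + ent M i (j - 1) * ent W (j - 1) j +
      ent M i j * ent W j j + ent M i (j + 1) * ent W (j + 1) j +
      ent M i (j + 2) * ent W (j + 2) j := by
  rw [ent_mul]
  refine sum_Ico_eq_of_band N (fun k => ent M i k * ent W k j) j (fun k hk => ?_) fun k hk => ?_
  · simp [ent_eq_zero_of_col _ hk]
  · simp [hW k j hk]

theorem ent_mul_of_banded_left {W : Matrix (Fin N) (Fin N) ℝ} (hW : IsBanded W)
    (M : Matrix (Fin N) (Fin N) ℝ) (i j : ℤ) :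
    ent (W * M) i j = ent W i (i - 2) * ent M (i - 2) j + ent W i (i - 1) * ent M (i - 1) j +
      ent W i i * ent M i j + ent W i (i + 1) * ent M (i + 1) j +
      ent W i (i + 2) * ent M (i + 2) j := by
  rw [ent_mul]
  refine sum_Ico_eq_of_band N (fun k => ent W i k * ent M k j) i (fun k hk => ?_) fun k hk => ?_
  · simp [ent_eq_zero_of_col _ hk]
  · simp [hW i k (by omega)]

theorem ent_lax (x : Space N) (i j : ℤ) :
    ent (lax x) i j = if i = j then be x i else if j = i + 1 then al x i
      else if i = j + 1 then al x j else 0 := by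
  by_cases h : (0 ≤ i ∧ i < N) ∧ 0 ≤ j ∧ j < N
  · obtain ⟨⟨hi, hi'⟩, hj, hj'⟩ := h
    lift i to ℕ using hi
    lift j to ℕ using hj
    rw [ent, dif_pos (by omega), lax]
    simp only [Matrix.of_apply, Int.toNat_natCast, al_coe, be_coe]
    norm_cast
  · rw [ent, dif_neg h]
    split_ifs with h1 h2 h3
    · rw [be_eq_zero]; omega
    · rw [al_eq_zero]; omega
    · rw [al_eq_zero]; omega
    · rfl

theorem ent_one (i j : ℤ) :
    ent (1 : Matrix (Fin N) (Fin N) ℝ) i j = if i = j ∧ 0 ≤ i ∧ i < N then 1 else 0 := by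
  by_cases h : (0 ≤ i ∧ i < N) ∧ 0 ≤ j ∧ j < N
  · obtain ⟨⟨hi, hi'⟩, hj, hj'⟩ := h
    lift i to ℕ using hi
    lift j to ℕ using hj
    have h1 := ent_coe (1 : Matrix (Fin N) (Fin N) ℝ) ⟨i, by omega⟩ ⟨j, by omega⟩
    rw [Matrix.one_apply] at h1
    refine h1.trans (if_congr ?_ rfl rfl)
    rw [Fin.mk.injEq]
    omega
  · rw [ent, dif_neg h, if_neg]
    omega

theorem ent_B₁ (x : Space N) (i j : ℤ) :
    ent (B₁ x) i j = if j = i + 1 then ((i : ℝ) + 2) * al x i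
      else if i = j + 1 then -(((j : ℝ) + 2) * al x j) else 0 := by
  by_cases h : (0 ≤ i ∧ i < N) ∧ 0 ≤ j ∧ j < N
  · obtain ⟨⟨hi, hi'⟩, hj, hj'⟩ := h
    lift i to ℕ using hi
    lift j to ℕ using hj
    rw [ent, dif_pos (by omega), B₁, skew]
    simp only [Matrix.of_apply, Int.toNat_natCast, al_coe, Int.cast_natCast]
    norm_cast
    split_ifs <;> first | omega | simp
  · rw [ent, dif_neg h]
    split_ifs with h1 h2
    · rw [al_eq_zero, mul_zero]; omega
    · rw [al_eq_zero, mul_zero, neg_zero]; omega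
    · rfl

theorem ent_B₂ (x : Space N) (i j : ℤ) :
    ent (B₂ x) i j =
      if j = i + 1 then al x i * (((i : ℝ) + 1) * (be x i + be x j) + partialSum x i)
      else if j = i + 2 then ((i : ℝ) + 1) * al x i * al x (i + 1)
      else if i = j + 1 then -(al x j * (((j : ℝ) + 1) * (be x j + be x i) + partialSum x j))
      else if i = j + 2 then -(((j : ℝ) + 1) * al x j * al x (j + 1))
      else 0 := by
  by_cases h : (0 ≤ i ∧ i < N) ∧ 0 ≤ j ∧ j < N
  · obtain ⟨⟨hi, hi'⟩, hj, hj'⟩ := h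
    lift i to ℕ using hi
    lift j to ℕ using hj
    rw [ent, dif_pos (by omega), B₂, skew]
    -- Folding `(i : ℤ) + 1` into a single cast lets `al_coe` apply to `al x (i + 1)`; the next line
    -- undoes the folding.
    simp only [Matrix.of_apply, Int.toNat_natCast, be_coe, Int.cast_natCast, partialSum,
      ← Nat.cast_succ, al_coe]
    simp only [Nat.cast_succ]
    norm_cast
    split_ifs <;> first | omega | simp
  · rw [ent, dif_neg h]
    split_ifs with h1 h2 h3 h4
    · rw [al_eq_zero, zero_mul]; omega
    · by_cases h5 : 0 ≤ i
      · rw [al_eq_zero x (i := i + 1), mul_zero]; omega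
      · rw [al_eq_zero x (i := i), mul_zero, zero_mul]; omega
    · rw [al_eq_zero, zero_mul, neg_zero]; omega
    · by_cases h5 : 0 ≤ j
      · rw [al_eq_zero x (i := j + 1), mul_zero, neg_zero]; omega
      · rw [al_eq_zero x (i := j), mul_zero, zero_mul, neg_zero]; omega
    · rfl

theorem isBanded_lax (x : Space N) : IsBanded (lax x) := fun i j h => by
  rw [ent_lax]; split_ifs <;> first | omega | rfl

theorem isBanded_B₁ (x : Space N) : IsBanded (B₁ x) := fun i j h => by
  rw [ent_B₁]; split_ifs <;> first | omega | rfl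

theorem isBanded_B₂ (x : Space N) : IsBanded (B₂ x) := fun i j h => by
  rw [ent_B₂]; split_ifs <;> first | omega | rfl

theorem ent_mul_lax (M : Matrix (Fin N) (Fin N) ℝ) (x : Space N) (i j : ℤ) :
    ent (M * lax x) i j =
      ent M i (j - 1) * al x (j - 1) + ent M i j * be x j + ent M i (j + 1) * al x j := by
  rw [ent_mul_of_banded M (isBanded_lax x)]
  simp (disch := omega) only [ent_lax, if_neg, if_true, sub_add_cancel]
  ring

theorem ent_lax_mul (M : Matrix (Fin N) (Fin N) ℝ) (x : Space N) (i j : ℤ) :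
    ent (lax x * M) i j =
      al x (i - 1) * ent M (i - 1) j + be x i * ent M i j + al x i * ent M (i + 1) j := by
  rw [ent_mul_of_banded_left (isBanded_lax x)]
  simp (disch := omega) only [ent_lax, if_neg, if_true, sub_add_cancel]
  ring

end Entries

/-! ### The Toda flows in matrix form -/

section Flow

variable {N : ℕ}

theorem skew_transpose {ι : Type*} (u : ι → ι → ℝ) : (skew u).transpose = -skew u := by
  ext i j
  simp [skew]

theorem lax_isSymm (x : Space N) : (lax x).IsSymm := by
  refine ent_ext fun i j => ?_
  rw [ent_transpose, ent_lax, ent_lax]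
  split_ifs with h1 h2 h3 <;> first | omega | rfl | (rw [h1])

/-- The diagonal and superdiagonal entries of a matrix, as a point of the phase space. -/
def coords : Matrix (Fin N) (Fin N) ℝ →ₗ[ℝ] Space N where
  toFun M p := match p with
    | Sum.inl i => M ⟨i, by omega⟩ ⟨i + 1, by omega⟩
    | Sum.inr i => M i i
  map_add' M W := by
    funext p
    rcases p with i | i <;> rfl
  map_smul' c M := by
    funext p
    rcases p with i | i <;> rfl

theorem coords_inl (M : Matrix (Fin N) (Fin N) ℝ) (i : Fin (N - 1)) :
    coords M (Sum.inl i) = ent M (i : ℕ) ((i : ℕ) + 1) :=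
  (ent_coe M ⟨i, by omega⟩ ⟨i + 1, by omega⟩).symm

theorem coords_inr (M : Matrix (Fin N) (Fin N) ℝ) (i : Fin N) :
    coords M (Sum.inr i) = ent M (i : ℕ) (i : ℕ) :=
  (ent_coe M i i).symm

theorem al_coords (M : Matrix (Fin N) (Fin N) ℝ) (i : ℤ) :
    al (coords M) i = ent M i (i + 1) := by
  by_cases h : 0 ≤ i ∧ i + 1 < N
  · lift i to ℕ using h.1
    rw [al_coe, a_coe _ ⟨i, by omega⟩, coords_inl]
  · rw [al_eq_zero _ h]
    by_cases h1 : 0 ≤ i ∧ i < N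
    · rw [ent_eq_zero_of_col]; omega
    · rw [ent_eq_zero_of_row _ h1]

theorem be_coords (M : Matrix (Fin N) (Fin N) ℝ) (i : ℤ) :
    be (coords M) i = ent M i i := by
  by_cases h : 0 ≤ i ∧ i < N
  · lift i to ℕ using h.1
    rw [be_coe, b_coe _ ⟨i, by omega⟩, coords_inr]
  · rw [be_eq_zero _ h, ent_eq_zero_of_row _ h]

theorem coords_lax (x : Space N) : coords (lax x) = x := by
  funext p
  rcases p with i | i
  · rw [coords_inl, ent_lax, if_neg (by omega), if_pos rfl, al_coe, a_coe]
  · rw [coords_inr, ent_lax, if_pos rfl, be_coe, b_coe]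

theorem lax_injective : Function.Injective (lax : Space N → _) :=
  Function.LeftInverse.injective coords_lax

theorem lax_coords {M : Matrix (Fin N) (Fin N) ℝ} (hM : M.IsSymm)
    (h : ∀ i j, i + 2 ≤ j → ent M i j = 0) : lax (coords M) = M := by
  refine ent_ext fun i j => ?_
  rw [ent_lax, al_coords, al_coords, be_coords]
  split_ifs with h1 h2 h3
  · rw [h1]
  · rw [h2]
  · rw [h3, ent_symm hM]
  · by_cases h4 : i < j
    · rw [h i j (by omega)]
    · rw [ent_symm hM, h j i (by omega)]

/-- The lower triangular matrix `T` with `M = (T + Tᵀ) / 2` for symmetric `M`. -/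
def lower : Matrix (Fin N) (Fin N) ℝ →ₗ[ℝ] Matrix (Fin N) (Fin N) ℝ where
  toFun M := Matrix.of fun i j => if j < i then 2 * M i j else if i = j then M i j else 0
  map_add' M W := by
    ext i j
    simp only [Matrix.of_apply, Matrix.add_apply]
    split_ifs <;> ring
  map_smul' c M := by
    ext i j
    simp only [Matrix.of_apply, Matrix.smul_apply, smul_eq_mul, RingHom.id_apply]
    split_ifs <;> ring

theorem ent_lower (M : Matrix (Fin N) (Fin N) ℝ) (i j : ℤ) :
    ent (lower M) i j = if j < i then 2 * ent M i j else if i = j then ent M i j else 0 := by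
  by_cases h : (0 ≤ i ∧ i < N) ∧ 0 ≤ j ∧ j < N
  · obtain ⟨⟨hi, hi'⟩, hj, hj'⟩ := h
    lift i to ℕ using hi
    lift j to ℕ using hj
    rw [ent, ent, dif_pos (by omega), dif_pos (by omega)]
    simp [lower]
  · simp [ent, dif_neg h]

theorem lower_add_transpose {M : Matrix (Fin N) (Fin N) ℝ} (hM : M.IsSymm) :
    lower M + (lower M).transpose = (2 : ℝ) • M := by
  refine ent_ext fun i j => ?_
  rw [ent_add, ent_transpose, ent_lower, ent_lower, ent_smul]
  rcases lt_trichotomy i j with h | h | h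
  · rw [if_neg (by omega), if_neg (by omega), if_pos h, ent_symm hM, zero_add]
  · subst h
    simp
    ring
  · rw [if_pos h, if_neg (by omega), if_neg (by omega), add_zero]

theorem lower_one : lower (1 : Matrix (Fin N) (Fin N) ℝ) = 1 := by
  ext i j
  simp only [lower, LinearMap.coe_mk, AddHom.coe_mk, Matrix.of_apply, Matrix.one_apply]
  split_ifs with h1 h2 <;> first | rfl | exact (mul_zero 2) | exact absurd h2 h1.ne'

/-- The vector field with `dL/dt = [T, L]`, `T = lower M`; for `M = L ^ m` it is the Hamiltonian
vector field of `H_{m+1}` with respect to the linear bracket. -/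
def flow (x : Space N) : Matrix (Fin N) (Fin N) ℝ →ₗ[ℝ] Space N where
  toFun M := coords (lower M * lax x - lax x * lower M)
  map_add' M W := by
    rw [← map_add, map_add]
    congr 1
    noncomm_ring
  map_smul' c M := by
    rw [RingHom.id_apply, ← map_smul, map_smul, Matrix.smul_mul, Matrix.mul_smul, smul_sub]

theorem flow_apply (x : Space N) (M : Matrix (Fin N) (Fin N) ℝ) :
    flow x M = coords (lower M * lax x - lax x * lower M) := rfl

theorem flow_one (x : Space N) : flow x 1 = 0 := by
  rw [flow_apply, lower_one, one_mul, mul_one, sub_self, map_zero]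

/-- Since `M` commutes with `L`, `[T, L] = [T - M, L]` with `T - M` skew, so the commutator is
symmetric. Since `T` is lower triangular, it vanishes above the superdiagonal. Hence it is
tridiagonal and `coords` loses nothing. -/
theorem lax_flow (x : Space N) {M : Matrix (Fin N) (Fin N) ℝ} (hM : M.IsSymm)
    (hc : M * lax x = lax x * M) :
    lax (flow x M) = lower M * lax x - lax x * lower M := by
  refine lax_coords ?_ fun i j h => ?_
  · have h1 : (lower M).transpose = (2 : ℝ) • M - lower M := by
      rw [← lower_add_transpose hM]; abel
    rw [Matrix.IsSymm, Matrix.transpose_sub, Matrix.transpose_mul, Matrix.transpose_mul,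
      (lax_isSymm x).eq, h1, mul_sub, sub_mul, Matrix.mul_smul, Matrix.smul_mul, hc]
    abel
  · rw [ent_sub, ent_mul_lax, ent_lax_mul]
    simp only [ent_lower]
    simp (disch := omega) only [if_neg]
    simp

theorem al_flow (x : Space N) {M : Matrix (Fin N) (Fin N) ℝ} (i : ℤ) :
    al (flow x M) i = al x i * (ent M i i - ent M (i + 1) (i + 1)) := by
  rw [flow_apply, al_coords, ent_sub, ent_mul_lax, ent_lax_mul]
  simp only [ent_lower]
  simp (disch := omega) only [if_neg, if_true, add_sub_cancel_right]
  ring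

theorem be_flow (x : Space N) {M : Matrix (Fin N) (Fin N) ℝ} (i : ℤ) :
    be (flow x M) i =
      2 * al x (i - 1) * ent M i (i - 1) - 2 * al x i * ent M (i + 1) i := by
  rw [flow_apply, be_coords, ent_sub, ent_mul_lax, ent_lax_mul]
  simp only [ent_lower]
  simp (disch := omega) only [if_neg, if_pos, if_true]
  ring

/-- The components `be_flow` telescope, starting from the zero value of `al` at `-1`. -/
theorem partialSum_flow (x : Space N) {M : Matrix (Fin N) (Fin N) ℝ} (i : ℤ) :
    partialSum (flow x M) i = -(2 * al x (i - 1) * ent M i (i - 1)) := by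
  by_cases h : 0 ≤ i
  · lift i to ℕ using h
    induction i with
    | zero => rw [al_eq_zero x (by simp)]; simp [partialSum]
    | succ i ih =>
      rw [Nat.cast_succ, partialSum_succ, ih, be_flow, add_sub_cancel_right]
      ring
  · rw [al_eq_zero x (by omega), partialSum, Int.toNat_of_nonpos (by omega)]
    simp

/-- The left-hand side is skew, because `Tᵀ = 2M - T` and likewise for `[B, M]`. A skew matrix is
determined by its entries above the diagonal, and there `lower` contributes nothing, leaving only
the hypothesis `h`. -/
theorem lower_commutator_eq_zero {M B D : Matrix (Fin N) (Fin N) ℝ} (hM : M.IsSymm)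
    (hB : B.transpose = -B) (hD : D.transpose = -D)
    (h : ∀ i j, i < j → ent (lower M * B - B * lower M) i j = ent D i j) :
    lower (B * M - M * B) + (lower M * B - B * lower M) - D = 0 := by
  set S := B * M - M * B with hS
  have hSs : S.IsSymm := by
    rw [Matrix.IsSymm, hS, Matrix.transpose_sub, Matrix.transpose_mul, Matrix.transpose_mul, hB,
      hM.eq]
    noncomm_ring
  set C := lower S + (lower M * B - B * lower M) - D with hC
  have h1 : (lower M).transpose = (2 : ℝ) • M - lower M := by
    rw [← lower_add_transpose hM]; abel
  have h2 : (lower S).transpose = (2 : ℝ) • S - lower S := by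
    rw [← lower_add_transpose hSs]; abel
  have hCs : C.transpose = -C := by
    rw [hC, Matrix.transpose_sub, Matrix.transpose_add, Matrix.transpose_sub,
      Matrix.transpose_mul, Matrix.transpose_mul, hB, h1, h2, hD, hS, two_smul, two_smul]
    noncomm_ring
  have hu : ∀ i j, i < j → ent C i j = 0 := fun i j hij => by
    rw [hC, ent_sub, ent_add, h i j hij, ent_lower, if_neg (by omega), if_neg (by omega)]
    ring
  have hs : ∀ i j, ent C j i = -ent C i j := fun i j => by
    rw [← ent_transpose, hCs, ← neg_one_smul ℝ, ent_smul]
    ring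
  refine ent_ext fun i j => ?_
  rw [ent_zero]
  rcases lt_trichotomy i j with h | h | h
  · exact hu i j h
  · subst h
    linarith [hs i i]
  · rw [hs, hu j i h, neg_zero]

/-- Above the diagonal only the superdiagonal survives. There the commutator multiplies the entry of
`B₁` by `M i i - M (i+1) (i+1)`, which is how the flow scales `a_i`. -/
theorem ent_commutator_B₁ (x : Space N) (M : Matrix (Fin N) (Fin N) ℝ) {i j : ℤ} (h : i < j) :
    ent (lower M * B₁ x - B₁ x * lower M) i j = ent (B₁ (flow x M)) i j := by
  rw [ent_sub, ent_mul_of_banded _ (isBanded_B₁ x), ent_mul_of_banded_left (isBanded_B₁ x)]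
  simp only [ent_lower, ent_B₁, al_flow]
  by_cases h1 : j = i + 1
  · subst h1
    simp (disch := omega) only [if_neg, if_pos, if_true, add_sub_cancel_right]
    ring
  · simp (disch := omega) only [if_neg]
    ring

/-- The right-hand side is the derivative of `B₂` along the flow, by the product rule. On the
superdiagonal the commutator gives `M i (i-1)` the coefficient `2 i a_{i-1} a_i`, while the
`b`-terms give `2 (i+1) a_{i-1} a_i`; the derivative of the partial sum accounts for the difference.
-/
theorem ent_commutator_B₂ (x : Space N) (M : Matrix (Fin N) (Fin N) ℝ) {i j : ℤ}
    (h : i < j) :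
    ent (lower M * B₂ x - B₂ x * lower M) i j =
      if j = i + 1 then
        al (flow x M) i * (((i : ℝ) + 1) * (be x i + be x j) + partialSum x i) +
          al x i * (((i : ℝ) + 1) * (be (flow x M) i + be (flow x M) j) +
            partialSum (flow x M) i)
      else if j = i + 2 then
        ((i : ℝ) + 1) * (al (flow x M) i * al x (i + 1) + al x i * al (flow x M) (i + 1))
      else 0 := by
  rw [ent_sub, ent_mul_of_banded _ (isBanded_B₂ x), ent_mul_of_banded_left (isBanded_B₂ x)]
  simp only [ent_lower, ent_B₂, al_flow, be_flow, partialSum_flow]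
  by_cases h1 : j = i + 1
  · subst h1
    have e1 : i + 1 - 2 = i - 1 := by ring
    have e2 : i - 1 + 1 = i := by ring
    have e3 : i + 1 + 1 = i + 2 := by ring
    simp (disch := omega) only [if_neg, if_pos, if_true, add_sub_cancel_right, e1, e2, e3]
    push_cast
    ring
  by_cases h2 : j = i + 2
  · subst h2
    have e1 : i + 2 - 1 = i + 1 := by ring
    have e3 : i + 1 + 1 = i + 2 := by ring
    simp (disch := omega) only [if_neg, if_pos, if_true, add_sub_cancel_right, e1, e3]
    ring
  · simp (disch := omega) only [if_neg]
    ring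

/-! ### The Lax equations of `X_1` and `X_2` -/

theorem laxField_eq (B : Space N → Matrix (Fin N) (Fin N) ℝ) (k : ℕ) (x : Space N) :
    laxField B k x = coords (B x * lax x - lax x * B x + lax x ^ (k + 1)) := by
  funext p
  rcases p with i | i <;> rfl

theorem isSymm_laxField {B : Matrix (Fin N) (Fin N) ℝ} (hB : B.transpose = -B) (k : ℕ)
    (x : Space N) : (B * lax x - lax x * B + lax x ^ k).IsSymm := by
  rw [Matrix.IsSymm, Matrix.transpose_add, Matrix.transpose_sub, Matrix.transpose_mul,
    Matrix.transpose_mul, Matrix.transpose_pow, hB, (lax_isSymm x).eq]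
  noncomm_ring

/-- The only entry to fear above the band is `(i, i+2)`. There `[B₁, L]` gives `((i+2) - (i+3)) a_i
a_{i+1}`, which cancels the entry of `L ^ 2`. -/
theorem lax_laxField_B₁ (x : Space N) :
    lax (laxField B₁ 1 x) = B₁ x * lax x - lax x * B₁ x + lax x ^ 2 := by
  rw [laxField_eq]
  refine lax_coords (isSymm_laxField (skew_transpose _) _ x) fun i j h => ?_
  rw [pow_two, ent_add, ent_sub, ent_mul_lax, ent_lax_mul, ent_mul_lax]
  simp only [ent_lax, ent_B₁]
  by_cases h1 : j = i + 2
  · subst h1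
    have e1 : i + 2 - 1 = i + 1 := by ring
    have e2 : i + 1 + 1 = i + 2 := by ring
    simp (disch := omega) only [if_neg, if_true, e1, e2]
    push_cast
    ring
  · simp (disch := omega) only [if_neg]
    ring

/-- The second and third superdiagonals of `[B₂, L]` cancel those of `L ^ 3`. On the second one, the
entry of `L ^ 3` is `a_i a_{i+1} (b_i + b_{i+1} + b_{i+2})`, and the increment of the partial sum
supplies a missing `b_i`. -/
theorem lax_laxField_B₂ (x : Space N) :
    lax (laxField B₂ 2 x) = B₂ x * lax x - lax x * B₂ x + lax x ^ 3 := by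
  rw [laxField_eq]
  refine lax_coords (isSymm_laxField (skew_transpose _) _ x) fun i j h => ?_
  rw [pow_succ, pow_two, ent_add, ent_sub, ent_mul_lax, ent_lax_mul, ent_mul_lax, ent_mul_lax,
    ent_mul_lax, ent_mul_lax]
  simp only [ent_lax, ent_B₂]
  by_cases h1 : j = i + 2
  · subst h1
    have e1 : i + 2 - 1 = i + 1 := by ring
    have e2 : i + 1 + 1 = i + 2 := by ring
    simp (disch := omega) only [if_neg, if_true, e1, e2, add_sub_cancel_right,
      partialSum_succ]
    push_cast
    ring
  by_cases h2 : j = i + 3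
  · subst h2
    have e1 : i + 3 - 1 = i + 2 := by ring
    have e2 : i + 1 + 1 = i + 2 := by ring
    have e3 : i + 2 - 1 = i + 1 := by ring
    simp (disch := omega) only [if_neg, if_pos, if_true, e1, e2, e3, add_sub_cancel_right]
    push_cast
    ring
  · simp (disch := omega) only [if_neg]
    ring

end Flow

/-! ### Derivatives of powers of the Lax matrix -/

section Calculus

variable {N : ℕ}

attribute [local instance] Matrix.linftyOpNormedRing Matrix.linftyOpNormedAlgebra

/-- The Lax matrix as a continuous linear map. -/
def laxCLM (N : ℕ) : Space N →L[ℝ] Matrix (Fin N) (Fin N) ℝ :=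
  LinearMap.toContinuousLinearMap
    { toFun := lax
      map_add' := fun x y => by
        refine ent_ext fun i j => ?_
        simp only [ent_add, ent_lax, al, be, a, b]
        split_ifs <;> simp
      map_smul' := fun c x => by
        refine ent_ext fun i j => ?_
        simp only [RingHom.id_apply, ent_smul, ent_lax, al, be, a, b]
        split_ifs <;> simp }

theorem laxCLM_apply (x : Space N) : laxCLM N x = lax x := rfl

theorem lax_add (x y : Space N) : lax (x + y) = lax x + lax y := (laxCLM N).map_add x y

theorem lax_smul (c : ℝ) (x : Space N) : lax (c • x) = c • lax x := (laxCLM N).map_smul c x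

theorem hasFDerivAt_lax (x : Space N) : HasFDerivAt lax (laxCLM N) x := (laxCLM N).hasFDerivAt

theorem contDiff_lax : ContDiff ℝ ∞ (lax : Space N → _) := (laxCLM N).contDiff

theorem contDiff_lax_pow (m : ℕ) : ContDiff ℝ ∞ fun y : Space N => lax y ^ m :=
  contDiff_lax.pow m

theorem differentiableAt_lax_pow (m : ℕ) (x : Space N) :
    DifferentiableAt ℝ (fun y : Space N => lax y ^ m) x :=
  (contDiff_lax_pow m).differentiable (by simp) x

theorem fderiv_lax (x v : Space N) : fderiv ℝ lax x v = lax v := by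
  rw [(hasFDerivAt_lax x).fderiv, laxCLM_apply]

/-- The derivative of `L ^ m` along a direction in which `L` moves by `[B, L] + S`, where `S`
commutes with `L`. -/
theorem fderiv_lax_pow_of_eq {x v : Space N} {B S : Matrix (Fin N) (Fin N) ℝ}
    (hv : lax v = B * lax x - lax x * B + S) (hS : Commute (lax x) S) (m : ℕ) :
    fderiv ℝ (fun y => lax y ^ m) x v =
      B * lax x ^ m - lax x ^ m * B + (m : ℝ) • (lax x ^ (m - 1) * S) := by
  induction m with
  | zero => simp
  | succ m ih =>
    have hmul : fderiv ℝ (fun y => lax y ^ (m + 1)) x v =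
        lax x ^ m * lax v + fderiv ℝ (fun y => lax y ^ m) x v * lax x := by
      have h := ((differentiableAt_lax_pow m x).hasFDerivAt.mul' (hasFDerivAt_lax x)).fderiv
      simp only [pow_succ]
      exact congrArg (fun f => f v) h
    rw [hmul, hv, ih, pow_succ]
    -- For `m = 0` the exponent `m - 1` is truncated, but the factor `m` vanishes.
    have h1 : (m : ℝ) • (lax x ^ (m - 1) * S) * lax x = (m : ℝ) • (lax x ^ m * S) := by
      rcases m with _ | m
      · simp
      · rw [Matrix.smul_mul, mul_assoc, ← hS.eq, ← mul_assoc, Nat.add_sub_cancel, pow_succ]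
    rw [add_mul, h1, Nat.add_sub_cancel, Nat.cast_succ, add_smul, one_smul]
    noncomm_ring

/-- The trace as a continuous linear map. -/
def traceCLM (N : ℕ) : Matrix (Fin N) (Fin N) ℝ →L[ℝ] ℝ :=
  LinearMap.toContinuousLinearMap (Matrix.traceLinearMap (Fin N) ℝ ℝ)

theorem contDiff_trace_pow (m : ℕ) : ContDiff ℝ ∞ fun y : Space N => (lax y ^ m).trace :=
  (traceCLM N).contDiff.comp (contDiff_lax_pow m)

/-- Each of the `m` terms of the noncommutative power rule has the same trace, by cyclicity and
because `K` commutes with `L`. -/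
theorem trace_mul_fderiv_lax_pow {K : Matrix (Fin N) (Fin N) ℝ} {x : Space N}
    (hK : Commute K (lax x)) (v : Space N) (m : ℕ) :
    (K * fderiv ℝ (fun y => lax y ^ m) x v).trace = m * (K * lax x ^ (m - 1) * lax v).trace := by
  have hp : fderiv ℝ (fun y => lax y ^ m) x v =
      ∑ i ∈ Finset.range m, lax x ^ (m.pred - i) * lax v * lax x ^ i := by
    refine (congrArg (fun f => f v) ((hasFDerivAt_lax x).fun_pow' m).fderiv).trans ?_
    refine (sum_apply _ _ _).trans ?_
    rfl
  rw [hp, Finset.mul_sum, Matrix.trace_sum,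
    Finset.sum_congr rfl (g := fun _ => (K * lax x ^ (m - 1) * lax v).trace)]
  · simp
  · intro i hi
    rw [Finset.mem_range] at hi
    rw [← mul_assoc, Matrix.trace_mul_comm, ← mul_assoc, ← mul_assoc, ← (hK.pow_right i).eq,
      mul_assoc K, ← pow_add]
    congr 4
    rw [Nat.pred_eq_sub_one]
    omega

theorem fderiv_trace_pow (x v : Space N) (m : ℕ) :
    fderiv ℝ (fun y => (lax y ^ m).trace) x v = m * (lax x ^ (m - 1) * lax v).trace := by
  have h : HasFDerivAt (fun y => (lax y ^ m).trace)
      ((traceCLM N).comp (fderiv ℝ (fun y => lax y ^ m) x)) x :=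
    (traceCLM N).hasFDerivAt.comp x (differentiableAt_lax_pow m x).hasFDerivAt
  have h1 : fderiv ℝ (fun y => (lax y ^ m).trace) x v =
      (1 * fderiv ℝ (fun y => lax y ^ m) x v).trace := by rw [h.fderiv, one_mul]; rfl
  rw [h1, trace_mul_fderiv_lax_pow (Commute.one_left _), one_mul]

/-- The entries of the derivative of a matrix-valued function. -/
theorem ent_fderiv {F : Space N → Matrix (Fin N) (Fin N) ℝ} {x : Space N}
    (hF : DifferentiableAt ℝ F x) (v : Space N) (i j : ℤ) :
    ent (fderiv ℝ F x v) i j = fderiv ℝ (fun y => ent (F y) i j) x v := by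
  let E : Matrix (Fin N) (Fin N) ℝ →L[ℝ] ℝ := LinearMap.toContinuousLinearMap
    { toFun := fun M => ent M i j
      map_add' := fun M W => ent_add M W i j
      map_smul' := fun c M => ent_smul c M i j }
  have h : HasFDerivAt (fun y => ent (F y) i j) (E.comp (fderiv ℝ F x)) x :=
    E.hasFDerivAt.comp x hF.hasFDerivAt
  rw [h.fderiv]
  rfl

theorem contDiff_matrix {E : Type*} [NormedAddCommGroup E] [NormedSpace ℝ E]
    {F : E → Matrix (Fin N) (Fin N) ℝ}
    (hF : ∀ i j, ContDiff ℝ ∞ fun y => F y i j) : ContDiff ℝ ∞ F := by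
  have h : F = fun y => ∑ i, ∑ j, F y i j • Matrix.single i j (1 : ℝ) := by
    funext y
    conv_lhs => rw [Matrix.matrix_eq_sum_single (F y)]
    simp [Matrix.smul_single]
  rw [h]
  exact ContDiff.sum fun i _ => ContDiff.sum fun j _ => (hF i j).smul contDiff_const

theorem contDiff_al (i : ℤ) : ContDiff ℝ ∞ fun y : Space N => al y i := by
  unfold al a
  split_ifs <;> fun_prop

theorem contDiff_be (i : ℤ) : ContDiff ℝ ∞ fun y : Space N => be y i := by
  unfold be b
  split_ifs <;> fun_prop

theorem contDiff_partialSum (i : ℤ) : ContDiff ℝ ∞ fun y : Space N => partialSum y i := by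
  unfold partialSum b
  refine ContDiff.sum fun k _ => ?_
  split_ifs <;> fun_prop

end Calculus

/-! ### Master symmetries -/

section MasterSymmetries

variable {N : ℕ}

attribute [local instance] Matrix.linftyOpNormedRing Matrix.linftyOpNormedAlgebra

/-- The Hamiltonian vector field of `H_{m+1}` with respect to the linear bracket. -/
def hamiltonianField (m : ℕ) (x : Space N) : Space N := flow x (lax x ^ m)

theorem lax_pow_isSymm (x : Space N) (m : ℕ) : (lax x ^ m).IsSymm := (lax_isSymm x).pow m

theorem lax_hamiltonianField (m : ℕ) (x : Space N) :
    lax (hamiltonianField m x) = lower (lax x ^ m) * lax x - lax x * lower (lax x ^ m) :=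
  lax_flow x (lax_pow_isSymm x m) (pow_mul_comm' (lax x) m)

theorem contDiff_coords_comp {F : Space N → Matrix (Fin N) (Fin N) ℝ} (hF : ContDiff ℝ ∞ F) :
    ContDiff ℝ ∞ fun x => coords (F x) :=
  (LinearMap.toContinuousLinearMap coords).contDiff.comp hF

theorem contDiff_lower_comp {F : Space N → Matrix (Fin N) (Fin N) ℝ} (hF : ContDiff ℝ ∞ F) :
    ContDiff ℝ ∞ fun x => lower (F x) :=
  (LinearMap.toContinuousLinearMap lower).contDiff.comp hF

theorem contDiff_hamiltonianField (m : ℕ) : ContDiff ℝ ∞ (hamiltonianField (N := N) m) := by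
  have h := contDiff_lower_comp (contDiff_lax_pow (N := N) m)
  exact contDiff_coords_comp ((h.mul contDiff_lax).sub (contDiff_lax.mul h))

theorem fderiv_matrix_mul {F G : Space N → Matrix (Fin N) (Fin N) ℝ} {x : Space N}
    (hF : DifferentiableAt ℝ F x) (hG : DifferentiableAt ℝ G x) (v : Space N) :
    fderiv ℝ (fun y => F y * G y) x v = F x * fderiv ℝ G x v + fderiv ℝ F x v * G x :=
  congrArg (fun f => f v) (hF.hasFDerivAt.mul' hG.hasFDerivAt).fderiv

theorem fderiv_matrix_add {F G : Space N → Matrix (Fin N) (Fin N) ℝ} {x : Space N}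
    (hF : DifferentiableAt ℝ F x) (hG : DifferentiableAt ℝ G x) (v : Space N) :
    fderiv ℝ (fun y => F y + G y) x v = fderiv ℝ F x v + fderiv ℝ G x v :=
  congrArg (fun f => f v) (hF.hasFDerivAt.add hG.hasFDerivAt).fderiv

theorem fderiv_matrix_sub {F G : Space N → Matrix (Fin N) (Fin N) ℝ} {x : Space N}
    (hF : DifferentiableAt ℝ F x) (hG : DifferentiableAt ℝ G x) (v : Space N) :
    fderiv ℝ (fun y => F y - G y) x v = fderiv ℝ F x v - fderiv ℝ G x v :=
  congrArg (fun f => f v) (hF.hasFDerivAt.sub hG.hasFDerivAt).fderiv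

theorem lax_fderiv {F : Space N → Space N} {x : Space N} (hF : DifferentiableAt ℝ F x)
    (v : Space N) : lax (fderiv ℝ F x v) = fderiv ℝ (fun y => lax (F y)) x v := by
  have h : HasFDerivAt (fun y => lax (F y)) ((laxCLM N).comp (fderiv ℝ F x)) x :=
    (laxCLM N).hasFDerivAt.comp x hF.hasFDerivAt
  rw [h.fderiv]
  rfl

theorem fderiv_lower {F : Space N → Matrix (Fin N) (Fin N) ℝ} {x : Space N}
    (hF : DifferentiableAt ℝ F x) (v : Space N) :
    fderiv ℝ (fun y => lower (F y)) x v = lower (fderiv ℝ F x v) := by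
  have h : HasFDerivAt (fun y => lower (F y))
      ((LinearMap.toContinuousLinearMap lower).comp (fderiv ℝ F x)) x :=
    (LinearMap.toContinuousLinearMap lower).hasFDerivAt.comp x hF.hasFDerivAt
  rw [h.fderiv]
  rfl

theorem fderiv_skew {B : Space N → Matrix (Fin N) (Fin N) ℝ} {x : Space N}
    (hB : DifferentiableAt ℝ B x) (hs : ∀ y, (B y).transpose = -B y) (v : Space N) :
    (fderiv ℝ B x v).transpose = -fderiv ℝ B x v := by
  refine ent_ext fun i j => ?_
  have h : (fun y => ent (B y) j i) = fun y => -ent (B y) i j := by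
    funext y
    rw [← ent_transpose, hs, ← neg_one_smul ℝ, ent_smul, neg_one_mul]
  rw [ent_transpose, ← neg_one_smul ℝ, ent_smul, ent_fderiv hB, ent_fderiv hB, h, fderiv_fun_neg,
    neg_apply, neg_one_mul]

/-- Compare `dL/dt` on both sides. The derivative of `L ^ m` along `X` is `[B, L ^ m] + m L ^
(m+e-1)`, whose second term yields the right-hand side. By the Jacobi identity for commutators the
rest is `[C, L]` with `C = lower [B, L ^ m] + [T, B] - dB(χ_m)`, and `C = 0` by
`lower_commutator_eq_zero`. -/
theorem lieBracket_hamiltonianField {X : Space N → Space N}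
    {B : Space N → Matrix (Fin N) (Fin N) ℝ} {e : ℕ} (hX : ContDiff ℝ ∞ X) (hB : ContDiff ℝ ∞ B)
    (hs : ∀ x, (B x).transpose = -B x)
    (hl : ∀ x, lax (X x) = B x * lax x - lax x * B x + lax x ^ e)
    (hD : ∀ x m i j, i < j → ent (lower (lax x ^ m) * B x - B x * lower (lax x ^ m)) i j =
      ent (fderiv ℝ B x (hamiltonianField m x)) i j) (m : ℕ) :
    VectorField.lieBracket ℝ X (hamiltonianField m) =
      (m : ℝ) • hamiltonianField (m + e - 1) := by
  funext x
  have dX : DifferentiableAt ℝ X x := hX.differentiable (by simp) x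
  have dB : DifferentiableAt ℝ B x := hB.differentiable (by simp) x
  have dχ : DifferentiableAt ℝ (hamiltonianField m) x :=
    (contDiff_hamiltonianField m).differentiable (by simp) x
  have dL : DifferentiableAt ℝ lax x := (hasFDerivAt_lax x).differentiableAt
  have dM := differentiableAt_lax_pow m x
  have dE := differentiableAt_lax_pow e x
  have dT : DifferentiableAt ℝ (fun y => lower (lax y ^ m)) x :=
    (contDiff_lower_comp (contDiff_lax_pow m)).differentiable (by simp) x
  have hχ := lax_hamiltonianField m x
  have h1 : lax (fderiv ℝ (hamiltonianField m) x (X x)) =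
      lower (lax x ^ m) * lax (X x) + lower (fderiv ℝ (fun y => lax y ^ m) x (X x)) * lax x -
        (lax x * lower (fderiv ℝ (fun y => lax y ^ m) x (X x)) +
          lax (X x) * lower (lax x ^ m)) := by
    rw [lax_fderiv dχ, funext (lax_hamiltonianField (N := N) m),
      fderiv_matrix_sub (dT.fun_mul dL) (dL.fun_mul dT), fderiv_matrix_mul dT dL,
      fderiv_matrix_mul dL dT, fderiv_lower dM, fderiv_lax]
  have h2 : lax (fderiv ℝ X x (hamiltonianField m x)) =
      B x * lax (hamiltonianField m x) + fderiv ℝ B x (hamiltonianField m x) * lax x -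
        (lax x * fderiv ℝ B x (hamiltonianField m x) + lax (hamiltonianField m x) * B x) +
        fderiv ℝ (fun y => lax y ^ e) x (hamiltonianField m x) := by
    rw [lax_fderiv dX, funext hl,
      fderiv_matrix_add ((dB.fun_mul dL).fun_sub (dL.fun_mul dB)) dE,
      fderiv_matrix_sub (dB.fun_mul dL) (dL.fun_mul dB),
      fderiv_matrix_mul dB dL, fderiv_matrix_mul dL dB, fderiv_lax]
  have h3 := fderiv_lax_pow_of_eq (hl x) ((Commute.refl (lax x)).pow_right e) m
  -- The flow of `χ_m` is a pure commutator, hence `S = 0`.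
  have h4 := fderiv_lax_pow_of_eq (x := x) (v := hamiltonianField m x) (B := lower (lax x ^ m)) (S := 0)
    (by rw [hχ, add_zero]) (Commute.zero_right _) e
  have h5 := lower_commutator_eq_zero (lax_pow_isSymm x m) (hs x)
    (fderiv_skew dB hs (hamiltonianField m x)) (hD x m)
  apply lax_injective
  have h6 : lax (VectorField.lieBracket ℝ X (hamiltonianField m) x) =
      lax (fderiv ℝ (hamiltonianField m) x (X x)) - lax (fderiv ℝ X x (hamiltonianField m x)) :=
    (laxCLM N).map_sub _ _
  have h7 : (m : ℝ) • (lax x ^ (m - 1) * lax x ^ e) = (m : ℝ) • lax x ^ (m + e - 1) := by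
    rcases m with _ | m
    · simp
    · rw [← pow_add]
      congr 2
      omega
  rw [h6, h1, h2, h4, Pi.smul_apply, lax_smul, hχ, lax_hamiltonianField, h3, h7, map_add, map_smul,
    hl, mul_zero, smul_zero, add_zero]
  set M := lax x ^ m
  set L := lax x
  set D := fderiv ℝ B x (hamiltonianField m x)
  have h8 : lower (B x * M - M * B x) = D - (lower M * B x - B x * lower M) := by
    rw [← sub_eq_zero, ← h5]
    abel
  rw [h8]
  simp only [add_mul, mul_add, Matrix.smul_mul, Matrix.mul_smul, smul_sub]
  noncomm_ring

/-- The vector field acts on the traces of powers and on the Hamiltonian fields like the master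
symmetry `X_{e-1}`. -/
structure IsMasterSymmetry (e : ℕ) (X : Space N → Space N) : Prop where
  smooth : ContDiff ℝ ∞ X
  trace : ∀ m x, fderiv ℝ (fun y => (lax y ^ m).trace) x (X x) =
    m * (lax x ^ (m + e - 1)).trace
  bracket : ∀ m, VectorField.lieBracket ℝ X (hamiltonianField m) =
    (m : ℝ) • hamiltonianField (m + e - 1)

theorem IsMasterSymmetry.of_lax {X : Space N → Space N}
    {B : Space N → Matrix (Fin N) (Fin N) ℝ} {e : ℕ} (hX : ContDiff ℝ ∞ X) (hB : ContDiff ℝ ∞ B)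
    (hs : ∀ x, (B x).transpose = -B x)
    (hl : ∀ x, lax (X x) = B x * lax x - lax x * B x + lax x ^ e)
    (hD : ∀ x m i j, i < j → ent (lower (lax x ^ m) * B x - B x * lower (lax x ^ m)) i j =
      ent (fderiv ℝ B x (hamiltonianField m x)) i j) : IsMasterSymmetry e X where
  smooth := hX
  trace m x := by
    rw [fderiv_trace_pow, hl]
    rcases m with _ | m
    · simp
    · have h : (lax x ^ m * (B x * lax x)).trace = (lax x ^ m * (lax x * B x)).trace := by
        rw [← mul_assoc, Matrix.trace_mul_comm, ← mul_assoc, ← mul_assoc, pow_mul_comm']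
      rw [Nat.add_sub_cancel, mul_add, mul_sub, Matrix.trace_add, Matrix.trace_sub, h, sub_self,
        zero_add, ← pow_add]
      congr 4
      omega
  bracket := lieBracket_hamiltonianField hX hB hs hl hD

/-! ### The master symmetries `X_{-1}`, `X_0`, `X_1`, `X_2` -/

theorem IsMasterSymmetry.of_lax_zero {X : Space N → Space N} {e : ℕ} (hX : ContDiff ℝ ∞ X)
    (hl : ∀ x, lax (X x) = lax x ^ e) : IsMasterSymmetry e X :=
  .of_lax (B := fun _ => 0) hX contDiff_const (by simp) (by simpa using hl) (by simp)

theorem lax_translationField (x : Space N) : lax (translationField x) = 1 := by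
  refine ent_ext fun i j => ?_
  rw [ent_lax, ent_one]
  simp only [al, be, a, b, translationField, dite_eq_ite]
  split_ifs <;> first | rfl | omega

theorem isMasterSymmetry_translation : IsMasterSymmetry 0 (translationField (N := N)) := by
  refine .of_lax_zero ?_ fun _ => ?_
  · exact contDiff_const
  · rw [lax_translationField, pow_zero]

theorem isMasterSymmetry_zero : IsMasterSymmetry 1 (masterSymmetry (N := N) 0) :=
  .of_lax_zero contDiff_id fun _ => (pow_one _).symm

theorem contDiff_laxField {B : Space N → Matrix (Fin N) (Fin N) ℝ} (hB : ContDiff ℝ ∞ B) (k : ℕ) :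
    ContDiff ℝ ∞ (laxField B k) := by
  have h : laxField B k = _ := funext (laxField_eq B k)
  rw [h]
  exact contDiff_coords_comp
    (((hB.mul contDiff_lax).sub (contDiff_lax.mul hB)).add (contDiff_lax_pow _))

theorem contDiff_B₁ : ContDiff ℝ ∞ (B₁ : Space N → _) := by
  refine contDiff_matrix fun i j => ?_
  simp only [← ent_coe, ent_B₁]
  have h := contDiff_al (N := N)
  split_ifs
  · exact contDiff_const.mul (h _)
  · exact (contDiff_const.mul (h _)).neg
  · exact contDiff_const

theorem contDiff_B₂ : ContDiff ℝ ∞ (B₂ : Space N → _) := by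
  refine contDiff_matrix fun i j => ?_
  simp only [← ent_coe, ent_B₂]
  have h := contDiff_al (N := N)
  have h' := contDiff_be (N := N)
  have h'' := contDiff_partialSum (N := N)
  split_ifs
  · exact (h _).mul ((contDiff_const.mul ((h' _).add (h' _))).add (h'' _))
  · exact (contDiff_const.mul (h _)).mul (h _)
  · exact ((h _).mul ((contDiff_const.mul ((h' _).add (h' _))).add (h'' _))).neg
  · exact ((contDiff_const.mul (h _)).mul (h _)).neg
  · exact contDiff_const

/-- The extended coordinate `a` as a continuous linear functional. -/
def alCLM (N : ℕ) (i : ℤ) : Space N →L[ℝ] ℝ :=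
  LinearMap.toContinuousLinearMap
    { toFun := fun y => al y i
      map_add' := fun y z => by simp only [al, a]; split_ifs <;> simp
      map_smul' := fun c y => by simp only [al, a]; split_ifs <;> simp }

/-- The extended coordinate `b` as a continuous linear functional. -/
def beCLM (N : ℕ) (i : ℤ) : Space N →L[ℝ] ℝ :=
  LinearMap.toContinuousLinearMap
    { toFun := fun y => be y i
      map_add' := fun y z => by simp only [be, b]; split_ifs <;> simp
      map_smul' := fun c y => by simp only [be, b]; split_ifs <;> simp }

/-- The partial sums of the `b_k` as continuous linear functionals. -/
def partialSumCLM (N : ℕ) (i : ℤ) : Space N →L[ℝ] ℝ :=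
  LinearMap.toContinuousLinearMap
    { toFun := fun y => partialSum y i
      map_add' := fun y z => by
        simp only [partialSum, b, ← Finset.sum_add_distrib]
        refine Finset.sum_congr rfl fun k _ => ?_
        split_ifs <;> simp
      map_smul' := fun c y => by
        simp only [partialSum, b, RingHom.id_apply, smul_eq_mul, Finset.mul_sum]
        refine Finset.sum_congr rfl fun k _ => ?_
        split_ifs <;> simp }

theorem hasFDerivAt_al (x : Space N) (i : ℤ) : HasFDerivAt (fun y => al y i) (alCLM N i) x :=
  (alCLM N i).hasFDerivAt

theorem hasFDerivAt_be (x : Space N) (i : ℤ) : HasFDerivAt (fun y => be y i) (beCLM N i) x :=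
  (beCLM N i).hasFDerivAt

theorem hasFDerivAt_partialSum (x : Space N) (i : ℤ) :
    HasFDerivAt (fun y => partialSum y i) (partialSumCLM N i) x :=
  (partialSumCLM N i).hasFDerivAt

theorem alCLM_apply (i : ℤ) (v : Space N) : alCLM N i v = al v i := rfl

theorem beCLM_apply (i : ℤ) (v : Space N) : beCLM N i v = be v i := rfl

theorem partialSumCLM_apply (i : ℤ) (v : Space N) : partialSumCLM N i v = partialSum v i := rfl

theorem ent_fderiv_B₁ (x v : Space N) {i j : ℤ} (h : i < j) :
    ent (fderiv ℝ B₁ x v) i j = ent (B₁ v) i j := by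
  rw [ent_fderiv (contDiff_B₁.differentiable (by simp) x)]
  simp only [ent_B₁]
  by_cases h1 : j = i + 1
  · simp only [if_pos h1]
    rw [((hasFDerivAt_al x i).const_mul _).fderiv]
    rfl
  · simp (disch := omega) only [if_neg]
    simp

theorem ent_fderiv_B₂ (x v : Space N) {i j : ℤ} (h : i < j) :
    ent (fderiv ℝ B₂ x v) i j =
      if j = i + 1 then
        al v i * (((i : ℝ) + 1) * (be x i + be x j) + partialSum x i) +
          al x i * (((i : ℝ) + 1) * (be v i + be v j) + partialSum v i)
      else if j = i + 2 then
        ((i : ℝ) + 1) * (al v i * al x (i + 1) + al x i * al v (i + 1))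
      else 0 := by
  rw [ent_fderiv (contDiff_B₂.differentiable (by simp) x)]
  simp only [ent_B₂]
  by_cases h1 : j = i + 1
  · simp only [if_pos h1]
    rw [((hasFDerivAt_al x i).fun_mul ((((hasFDerivAt_be x i).fun_add (hasFDerivAt_be x j)).const_mul
      _).fun_add (hasFDerivAt_partialSum x i))).fderiv]
    simp only [add_apply, smul_apply, smul_eq_mul, alCLM_apply, beCLM_apply, partialSumCLM_apply]
    ring
  by_cases h2 : j = i + 2
  · simp only [if_neg h1, if_pos h2]
    rw [(((hasFDerivAt_al x i).const_mul _).fun_mul (hasFDerivAt_al x (i + 1))).fderiv]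
    simp only [add_apply, smul_apply, smul_eq_mul, alCLM_apply]
    ring
  · simp (disch := omega) only [if_neg]
    simp

theorem isMasterSymmetry_one : IsMasterSymmetry 2 (masterSymmetry (N := N) 1) :=
  .of_lax (contDiff_laxField contDiff_B₁ 1) contDiff_B₁ (fun _ => skew_transpose _)
    lax_laxField_B₁ fun x m _ _ h => by
      rw [ent_commutator_B₁ x _ h, ent_fderiv_B₁ _ _ h, hamiltonianField]

theorem isMasterSymmetry_two : IsMasterSymmetry 3 (masterSymmetry (N := N) 2) :=
  .of_lax (contDiff_laxField contDiff_B₂ 2) contDiff_B₂ (fun _ => skew_transpose _)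
    lax_laxField_B₂ fun x m _ _ h => by
      rw [ent_commutator_B₂ x _ h, ent_fderiv_B₂ _ _ h, hamiltonianField]

end MasterSymmetries

/-! ### The Lenard relations -/

section Lenard

variable {N : ℕ}

/-- The differential of `Tr L ^ (m + 1) / (m + 1)` in terms of the matrix `M = L ^ m`. -/
def gradTrace (M : Matrix (Fin N) (Fin N) ℝ) : Index N → ℝ
  | Sum.inl i => 2 * ent M (i : ℕ) ((i : ℕ) + 1)
  | Sum.inr i => ent M (i : ℕ) (i : ℕ)

theorem lax_single_inl (i : Fin (N - 1)) :
    lax (Pi.single (Sum.inl i) 1 : Space N) =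
      Matrix.single ⟨i, by omega⟩ ⟨i + 1, by omega⟩ 1 +
        Matrix.single ⟨i + 1, by omega⟩ ⟨i, by omega⟩ 1 := by
  ext p q
  have hp := p.2
  have hq := q.2
  have hi := i.2
  simp only [lax, a, b, Matrix.of_apply, Matrix.add_apply, Matrix.single_apply, Pi.single_apply,
    Sum.inl.injEq, reduceCtorEq, Fin.ext_iff]
  split_ifs <;> first | omega | contradiction | simp

theorem lax_single_inr (i : Fin N) :
    lax (Pi.single (Sum.inr i) 1 : Space N) = Matrix.single i i 1 := by
  ext p q
  have hp := p.2
  have hq := q.2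
  have hi := i.2
  simp only [lax, a, b, Matrix.of_apply, Matrix.single_apply, Pi.single_apply,
    Sum.inr.injEq, reduceCtorEq, Fin.ext_iff]
  split_ifs <;> first | omega | contradiction | rfl

/-- Each `a_i` occurs twice in `L`, whence the factor `2` in `gradTrace`. -/
theorem trace_mul_lax_single {M : Matrix (Fin N) (Fin N) ℝ} (hM : M.IsSymm) (p : Index N) :
    (M * lax (Pi.single p 1)).trace = gradTrace M p := by
  rcases p with i | i
  · rw [lax_single_inl, mul_add, Matrix.trace_add, Matrix.trace_mul_single,
      Matrix.trace_mul_single, gradTrace, two_mul]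
    have h := ent_coe M ⟨i, by omega⟩ ⟨i + 1, by omega⟩
    have h' := ent_coe M ⟨i + 1, by omega⟩ ⟨i, by omega⟩
    simp only [Nat.cast_succ] at h h'
    rw [← h, ← h', ent_symm hM]
    simp
  · rw [lax_single_inr, Matrix.trace_mul_single, gradTrace, ent_coe]
    simp

theorem pderiv_trace_pow (m : ℕ) (x : Space N) (p : Index N) :
    pderiv p (fun y => (lax y ^ m).trace) x = m * gradTrace (lax x ^ (m - 1)) p := by
  rw [pderiv, fderiv_trace_pow, trace_mul_lax_single (lax_pow_isSymm x _)]

theorem flow_inl (x : Space N) (M : Matrix (Fin N) (Fin N) ℝ) (j : Fin (N - 1)) :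
    flow x M (Sum.inl j) = al (flow x M) (j : ℕ) := by rw [al_coe, a_coe]

theorem flow_inr (x : Space N) (M : Matrix (Fin N) (Fin N) ℝ) (j : Fin N) :
    flow x M (Sum.inr j) = be (flow x M) (j : ℕ) := by rw [be_coe, b_coe]

/-- The tensor with coefficients `P = {a, a}`, `Q = {a, b} = -{b, a}` and `R = {b, b}`. -/
def blockTensor (P Q R : ℤ → ℤ → ℝ) : Matrix (Index N) (Index N) ℝ :=
  Matrix.of fun p q => match p, q with
    | Sum.inl i, Sum.inl j => P (i : ℕ) (j : ℕ)
    | Sum.inl i, Sum.inr j => Q (i : ℕ) (j : ℕ)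
    | Sum.inr i, Sum.inl j => -Q (j : ℕ) (i : ℕ)
    | Sum.inr i, Sum.inr j => R (i : ℕ) (j : ℕ)

theorem sum_band_offDiag (M : Matrix (Fin N) (Fin N) ℝ) (F : ℤ → ℝ) (j : ℤ)
    (hF : ∀ k : ℤ, ¬ (j - 2 ≤ k ∧ k ≤ j + 2) → F k = 0) :
    ∑ k : Fin (N - 1), F (k : ℕ) * (2 * ent M (k : ℕ) ((k : ℕ) + 1)) =
      2 * (F (j - 2) * ent M (j - 2) (j - 1) + F (j - 1) * ent M (j - 1) j +
        F j * ent M j (j + 1) + F (j + 1) * ent M (j + 1) (j + 2) +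
        F (j + 2) * ent M (j + 2) (j + 3)) := by
  rw [sum_fin_eq_of_band (N - 1) (fun k => F k * (2 * ent M k (k + 1))) j]
  · have e1 : j - 2 + 1 = j - 1 := by ring
    have e2 : j + 1 + 1 = j + 2 := by ring
    have e3 : j + 2 + 1 = j + 3 := by ring
    simp only [e1, e2, e3, sub_add_cancel]
    ring
  · intro k hk
    by_cases h : 0 ≤ k ∧ k < N
    · simp [ent_eq_zero_of_col (M := M) k (j := k + 1) (by omega)]
    · simp [ent_eq_zero_of_row (M := M) (k + 1) h]
  · intro k hk
    simp [hF k hk]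

theorem sum_band_diag (M : Matrix (Fin N) (Fin N) ℝ) (F : ℤ → ℝ) (j : ℤ)
    (hF : ∀ k : ℤ, ¬ (j - 2 ≤ k ∧ k ≤ j + 2) → F k = 0) :
    ∑ k : Fin N, F (k : ℕ) * ent M (k : ℕ) (k : ℕ) =
      F (j - 2) * ent M (j - 2) (j - 2) + F (j - 1) * ent M (j - 1) (j - 1) + F j * ent M j j +
        F (j + 1) * ent M (j + 1) (j + 1) + F (j + 2) * ent M (j + 2) (j + 2) := by
  rw [sum_fin_eq_of_band N (fun k => F k * ent M k k) j]
  · intro k hk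
    simp [ent_eq_zero_of_row (M := M) k hk]
  · intro k hk
    simp [hF k hk]

/-- A tensor with banded coefficients maps the differential given by `M` to the vector field given
by `W` as soon as this holds for the extended arrays. -/
theorem blockTensor_apply {P Q R : ℤ → ℤ → ℝ} {M W : Matrix (Fin N) (Fin N) ℝ} {x : Space N}
    (hP : ∀ i j, ¬ (j - 2 ≤ i ∧ i ≤ j + 2) → P i j = 0)
    (hQ : ∀ i j, ¬ (j - 2 ≤ i ∧ i ≤ j + 2) → Q i j = 0)
    (hR : ∀ i j, ¬ (j - 2 ≤ i ∧ i ≤ j + 2) → R i j = 0)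
    (ha : ∀ j : ℤ, 2 * (P (j - 2) j * ent M (j - 2) (j - 1) + P (j - 1) j * ent M (j - 1) j +
        P j j * ent M j (j + 1) + P (j + 1) j * ent M (j + 1) (j + 2) +
        P (j + 2) j * ent M (j + 2) (j + 3)) -
        (Q j (j - 2) * ent M (j - 2) (j - 2) + Q j (j - 1) * ent M (j - 1) (j - 1) +
        Q j j * ent M j j + Q j (j + 1) * ent M (j + 1) (j + 1) +
        Q j (j + 2) * ent M (j + 2) (j + 2)) = al x j * (ent W j j - ent W (j + 1) (j + 1)))
    (hb : ∀ j : ℤ, 2 * (Q (j - 2) j * ent M (j - 2) (j - 1) + Q (j - 1) j * ent M (j - 1) j +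
        Q j j * ent M j (j + 1) + Q (j + 1) j * ent M (j + 1) (j + 2) +
        Q (j + 2) j * ent M (j + 2) (j + 3)) +
        (R (j - 2) j * ent M (j - 2) (j - 2) + R (j - 1) j * ent M (j - 1) (j - 1) +
        R j j * ent M j j + R (j + 1) j * ent M (j + 1) (j + 1) +
        R (j + 2) j * ent M (j + 2) (j + 2)) =
        2 * al x (j - 1) * ent W j (j - 1) - 2 * al x j * ent W (j + 1) j)
    (q : Index N) : ∑ p, blockTensor P Q R p q * gradTrace M p = flow x W q := by
  rw [Fintype.sum_sum_type]
  rcases q with j | j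
  · rw [flow_inl, al_flow, ← ha]
    simp only [blockTensor, gradTrace, Matrix.of_apply]
    rw [sum_band_offDiag M (fun k => P k (j : ℕ)) (j : ℕ) (fun k hk => hP k _ hk),
      sum_band_diag M (fun k => -Q (j : ℕ) k) (j : ℕ) (fun k hk => by
        rw [hQ _ k (by omega), neg_zero])]
    ring
  · rw [flow_inr, be_flow, ← hb]
    simp only [blockTensor, gradTrace, Matrix.of_apply]
    rw [sum_band_offDiag M (fun k => Q k (j : ℕ)) (j : ℕ) (fun k hk => hQ k _ hk),
      sum_band_diag M (fun k => R k (j : ℕ)) (j : ℕ) (fun k hk => hR k _ hk)]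

end Lenard

/-! ### The linear, quadratic and cubic brackets on the traces -/

section Brackets

variable {N : ℕ}

theorem linearBracket_eq (x : Space N) :
    linearBracket x = blockTensor (fun _ _ => 0)
      (fun i j => if j = i then -al x i else if j = i + 1 then al x i else 0)
      (fun _ _ => 0) := by
  ext p q
  rcases p with i | i <;> rcases q with j | j <;>
    simp only [linearBracket, skew, blockTensor, Matrix.of_apply, al_coe, Nat.cast_inj,
      ← Nat.cast_succ, Nat.succ_eq_add_one, sub_zero, zero_sub]

theorem quadraticBracket_eq (x : Space N) :
    quadraticBracket x = blockTensor
      (fun i j => if j = i + 1 then 1 / 2 * al x i * al x j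
        else if i = j + 1 then -(1 / 2 * al x j * al x i) else 0)
      (fun i j => if j = i then -(al x i * be x j) else if j = i + 1 then al x i * be x j else 0)
      (fun i j => if j = i + 1 then 2 * al x i ^ 2
        else if i = j + 1 then -(2 * al x j ^ 2) else 0) := by
  ext p q
  rcases p with i | i <;> rcases q with j | j <;>
    simp only [quadraticBracket, skew, blockTensor, Matrix.of_apply, al_coe, be_coe, Nat.cast_inj,
      ← Nat.cast_succ, Nat.succ_eq_add_one, sub_zero, zero_sub] <;>
    split_ifs <;> first | omega | simp

theorem cubicBracket_eq (x : Space N) :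
    cubicBracket x = blockTensor
      (fun i j => if j = i + 1 then al x i * al x j * be x j
        else if i = j + 1 then -(al x j * al x i * be x i) else 0)
      (fun i j => if j = i then -(al x i * be x j ^ 2) - al x i ^ 3
        else if j = i + 1 then al x i * be x j ^ 2 + al x i ^ 3
        else if j = i + 2 then al x i * al x (i + 1) ^ 2
        else if i = j + 1 then -(al x j ^ 2 * al x i) else 0)
      (fun i j => if j = i + 1 then 2 * al x i ^ 2 * (be x i + be x j)
        else if i = j + 1 then -(2 * al x j ^ 2 * (be x j + be x i)) else 0) := by
  have h2 : ∀ i j : ℕ, ((j : ℤ) = i + 2) = (j = i + 2) := fun i j => by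
    rw [eq_iff_iff]; omega
  ext p q
  rcases p with i | i <;> rcases q with j | j <;>
    simp only [cubicBracket, skew, blockTensor, Matrix.of_apply, h2, al_coe, be_coe, Nat.cast_inj,
      ← Nat.cast_succ, Nat.succ_eq_add_one, sub_zero, zero_sub] <;>
    split_ifs <;> first | omega | simp

theorem linearBracket_apply (x : Space N) {M : Matrix (Fin N) (Fin N) ℝ} (hM : M.IsSymm)
    (q : Index N) : ∑ p, linearBracket x p q * gradTrace M p = flow x M q := by
  rw [linearBracket_eq]
  refine blockTensor_apply (fun _ _ _ => rfl) (fun i j h => ?_) (fun _ _ _ => rfl)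
    (fun j => ?_) (fun j => ?_) q
  · simp (disch := omega) only [if_neg]
  · simp (disch := omega) only [if_neg, if_true]
    ring
  · simp (disch := omega) only [if_neg, if_true, sub_add_cancel]
    rw [ent_symm hM j (j - 1), ent_symm hM (j + 1) j]
    ring

/-- On these covectors `π_2` acts as `π_1` after multiplying `M` by `L`. In the `b`-components one
off-diagonal entry is expanded as `L M` and the other as `M L`; this choice makes the two sides
agree term by term. -/
theorem quadraticBracket_apply (x : Space N) {M : Matrix (Fin N) (Fin N) ℝ} (hM : M.IsSymm)
    (hc : M * lax x = lax x * M) (q : Index N) :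
    ∑ p, quadraticBracket x p q * gradTrace M p = flow x (M * lax x) q := by
  rw [quadraticBracket_eq]
  refine blockTensor_apply (fun i j h => ?_) (fun i j h => ?_) (fun i j h => ?_)
    (fun j => ?_) (fun j => ?_) q
  iterate 3 simp (disch := omega) only [if_neg]
  · have e1 : j + 1 + 1 = j + 2 := by ring
    rw [ent_mul_lax, ent_mul_lax]
    simp (disch := omega) only [if_neg, if_true, sub_add_cancel, add_sub_cancel_right, e1]
    rw [ent_symm hM j (j - 1), ent_symm hM (j + 1) j]
    ring
  · have e2 : j - 1 - 1 = j - 2 := by ring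
    have h1 : ent (M * lax x) j (j - 1) = ent (lax x * M) j (j - 1) := by rw [hc]
    rw [h1, ent_mul_lax, ent_lax_mul]
    simp (disch := omega) only [if_neg, if_true, sub_add_cancel]
    rw [ent_symm hM j (j - 1), ent_symm hM (j + 1) j]
    ring

theorem cubicBracket_apply (x : Space N) {M : Matrix (Fin N) (Fin N) ℝ} (hM : M.IsSymm)
    (hc : M * lax x = lax x * M) (q : Index N) :
    ∑ p, cubicBracket x p q * gradTrace M p = flow x (M * lax x ^ 2) q := by
  have hW : (M * lax x).IsSymm := by
    rw [Matrix.IsSymm, Matrix.transpose_mul, hM.eq, (lax_isSymm x).eq, hc]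
  have hcW : M * lax x * lax x = lax x * (M * lax x) := by rw [← mul_assoc, ← hc]
  have hl : ∀ i j, ent (M * lax x) i j = ent (lax x * M) i j := fun i j => by rw [hc]
  rw [cubicBracket_eq, pow_two, ← mul_assoc]
  refine blockTensor_apply (fun i j h => ?_) (fun i j h => ?_) (fun i j h => ?_)
    (fun j => ?_) (fun j => ?_) q
  iterate 3 simp (disch := omega) only [if_neg]
  · have e1 : j + 1 + 1 = j + 2 := by ring
    have e4 : j + 2 + 1 = j + 3 := by ring
    have e5 : j - 1 + 1 = j := by ring
    have h1 : ent (M * lax x) j (j + 1) = ent (lax x * M) j (j + 1) := hl _ _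
    have h2 := hl j (j - 1)
    have h3 := hl (j + 1) (j + 2)
    rw [ent_lax_mul] at h3
    rw [ent_mul_lax, ent_mul_lax (M * lax x)]
    rw [add_sub_cancel_right, ent_symm hW (j + 1) j, h2, e1]
    rw [ent_mul_lax, ent_lax_mul] at h1
    rw [ent_mul_lax _ _ j j, ent_mul_lax _ _ (j + 1) (j + 1), ent_lax_mul]
    simp (disch := omega) only [if_neg, if_true, e5, e4, add_sub_cancel_right, e1]
      at h1 h3 ⊢
    rw [ent_symm hM (j + 1) (j - 1), ent_symm hM j (j - 1), ent_symm hM (j + 1) j]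
    -- The remaining discrepancy is a combination of the relation `M L = L M` at the entries `(j,
    -- j+1)` and `(j+1, j+2)`.
    linear_combination al x j ^ 2 * h1 + al x j * al x (j + 1) * h3
  · have e2 : j - 1 - 1 = j - 2 := by ring
    have e5 : j - 1 + 1 = j := by ring
    have e6 : j - 2 + 1 = j - 1 := by ring
    have e1 : j + 1 + 1 = j + 2 := by ring
    have h1 : ent (M * lax x * lax x) j (j - 1) = ent (lax x * (M * lax x)) j (j - 1) := by
      rw [hcW]
    have h2 := hl j (j - 1)
    rw [h1, ent_mul_lax, ent_lax_mul, h2]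
    simp only [ent_mul_lax, ent_lax_mul]
    simp (disch := omega) only [if_neg, if_true, e1, e2, e5, e6, sub_add_cancel,
      add_sub_cancel_right]
    rw [ent_symm hM (j - 1) (j - 2), ent_symm hM j (j - 1), ent_symm hM (j + 1) j]
    ring

end Brackets

/-! ### The Lenard relations along the hierarchy -/

section Hierarchy

variable {N : ℕ}

/-- Both actions pass to commutators: on functions by definition of the bracket, on the fields `χ_m`
by the Jacobi identity. Each time the coefficient is `m ((m+n+2) - (m+1)) = m (n+1)`, which the
normalisation reduces to `m`. -/
theorem IsMasterSymmetry.lieBracket_one {n : ℕ} {X Y : Space N → Space N}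
    (hX : IsMasterSymmetry 2 X) (hY : IsMasterSymmetry (n + 3) Y) :
    IsMasterSymmetry (n + 4) (((n : ℝ) + 1)⁻¹ • VectorField.lieBracket ℝ X Y) := by
  have hn : (n : ℝ) + 1 ≠ 0 := by positivity
  have dX := hX.smooth.differentiable (by simp)
  have dY := hY.smooth.differentiable (by simp)
  have hs : ContDiff ℝ ∞ (VectorField.lieBracket ℝ X Y) :=
    hX.smooth.lieBracket_vectorField (m := ∞) hY.smooth (by simp)
  refine ⟨contDiff_const.smul hs, fun m x => ?_, fun m => ?_⟩
  · have h1 := VectorField.fderiv_apply_lieBracket (x := x) (contDiff_trace_pow (N := N) m).contDiffAt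
      (by simpa using two_le_infty) (dY x) (dX x)
    have h2 : ∀ k (c : ℝ) (v : Space N),
        fderiv ℝ (fun y => c * (lax y ^ k).trace) x v =
          c * fderiv ℝ (fun y => (lax y ^ k).trace) x v := fun k c v => by
      rw [fderiv_const_mul ((contDiff_trace_pow k).differentiable (by simp) x), smul_apply,
        smul_eq_mul]
    rw [Pi.smul_apply, map_smul, h1]
    simp only [hX.trace, hY.trace, h2]
    rcases m with _ | m
    · simp
    · have e1 : m + 1 + (n + 3) - 1 + 2 - 1 = m + 1 + (n + 4) - 1 := by omega
      have e2 : m + 1 + 2 - 1 + (n + 3) - 1 = m + 1 + (n + 4) - 1 := by omega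
      have e3 : m + 1 + (n + 3) - 1 = m + n + 3 := by omega
      have e4 : m + 1 + 2 - 1 = m + 2 := by omega
      rw [e1, e2, e3, e4, smul_eq_mul]
      push_cast
      field_simp
      ring
  · funext x
    have hχ := contDiff_hamiltonianField (N := N)
    have dχ := fun k => (hχ k).differentiable (by simp)
    have h1 := VectorField.leibniz_identity_lieBracket (𝕜 := ℝ) (n := ∞) (x := x)
      (by simpa using two_le_infty) hX.smooth.contDiffAt hY.smooth.contDiffAt (hχ m).contDiffAt
    have h2 : ∀ {Z : Space N → Space N} {k : ℕ} {c : ℝ}, VectorField.lieBracket ℝ Z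
        (c • hamiltonianField k) x = c • VectorField.lieBracket ℝ Z (hamiltonianField k) x :=
      fun {Z k c} => VectorField.lieBracket_const_smul_right (dχ k x)
    rw [VectorField.lieBracket_const_smul_left (hs.differentiable (by simp) x)]
    rw [hX.bracket, hY.bracket, h2, h2, hX.bracket, hY.bracket] at h1
    rw [← sub_eq_iff_eq_add] at h1
    rw [← h1]
    rcases m with _ | m
    · simp
    · have e1 : m + 1 + (n + 3) - 1 + 2 - 1 = m + 1 + (n + 4) - 1 := by omega
      have e2 : m + 1 + 2 - 1 + (n + 3) - 1 = m + 1 + (n + 4) - 1 := by omega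
      have e3 : m + 1 + (n + 3) - 1 = m + n + 3 := by omega
      have e4 : m + 1 + 2 - 1 = m + 2 := by omega
      rw [e1, e2, e3, e4]
      simp only [Pi.smul_apply, smul_smul, ← sub_smul]
      congr 1
      push_cast
      field_simp
      ring

theorem isMasterSymmetry (k : ℕ) : IsMasterSymmetry (k + 1) (masterSymmetry (N := N) k) := by
  induction k using Nat.strong_induction_on with
  | _ k ih =>
    match k with
    | 0 => exact isMasterSymmetry_zero
    | 1 => exact isMasterSymmetry_one
    | 2 => exact isMasterSymmetry_two
    | n + 3 => exact isMasterSymmetry_one.lieBracket_one (ih (n + 2) (by omega))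

/-- The `n`-th Lenard relations `π dH_j = π_1 dH_{j+n-1}`. -/
structure HasLenardRelations (n : ℕ) (π : Space N → Matrix (Index N) (Index N) ℝ) : Prop where
  pos : 1 ≤ n
  smooth : ∀ p q, ContDiff ℝ ∞ fun x => π x p q
  sharp : ∀ j : ℕ, sharp π (fun x => (lax x ^ j).trace) = (j : ℝ) • hamiltonianField (j + n - 2)

/-- It suffices to take `M = L ^ (j-1)`, since `d Tr L ^ j = j · gradTrace (L ^ (j-1))`. -/
theorem HasLenardRelations.of_apply {n : ℕ} {π : Space N → Matrix (Index N) (Index N) ℝ}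
    (hπ : ∀ p q, ContDiff ℝ ∞ fun x => π x p q)
    (h : ∀ (x : Space N) (M : Matrix (Fin N) (Fin N) ℝ), M.IsSymm → M * lax x = lax x * M →
      ∀ q, ∑ p, π x p q * gradTrace M p = flow x (M * lax x ^ n) q) :
    HasLenardRelations (n + 1) π := by
  refine ⟨by omega, hπ, fun j => ?_⟩
  funext x q
  simp only [Toda.sharp, pderiv_trace_pow, mul_left_comm _ (j : ℝ), ← Finset.mul_sum]
  rw [h x _ (lax_pow_isSymm x _) (pow_mul_comm' _ _), ← pow_add, Pi.smul_apply, Pi.smul_apply,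
    smul_eq_mul, hamiltonianField]
  rcases j with _ | j
  · simp
  · have e1 : j + 1 + (n + 1) - 2 = j + 1 - 1 + n := by omega
    rw [e1]

/-! ### The Lenard relations for `π_1`, `π_2`, `π_3` -/

theorem contDiff_blockTensor {P Q R : Space N → ℤ → ℤ → ℝ}
    (hP : ∀ i j, ContDiff ℝ ∞ fun x => P x i j) (hQ : ∀ i j, ContDiff ℝ ∞ fun x => Q x i j)
    (hR : ∀ i j, ContDiff ℝ ∞ fun x => R x i j) (p q : Index N) :
    ContDiff ℝ ∞ fun x => (blockTensor (P x) (Q x) (R x) : Matrix (Index N) (Index N) ℝ) p q := by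
  rcases p with i | i <;> rcases q with j | j
  · exact hP _ _
  · exact hQ _ _
  · exact (hQ _ _).neg
  · exact hR _ _

theorem hasLenardRelations_linear : HasLenardRelations 1 (linearBracket (N := N)) := by
  refine .of_apply ?_ fun x M hM _ q => by rw [linearBracket_apply x hM, pow_zero, mul_one]
  have ha := contDiff_al (N := N)
  intro p q
  simp only [linearBracket_eq]
  refine contDiff_blockTensor (fun i j => contDiff_const) (fun i j => ?_)
    (fun i j => contDiff_const) p q
  split_ifs <;> fun_prop

theorem hasLenardRelations_quadratic : HasLenardRelations 2 (quadraticBracket (N := N)) := by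
  refine .of_apply ?_ fun x M hM hc q => by rw [quadraticBracket_apply x hM hc, pow_one]
  have ha := contDiff_al (N := N)
  have hb := contDiff_be (N := N)
  intro p q
  simp only [quadraticBracket_eq]
  refine contDiff_blockTensor (fun i j => ?_) (fun i j => ?_) (fun i j => ?_) p q <;>
    split_ifs <;> fun_prop

theorem hasLenardRelations_cubic : HasLenardRelations 3 (cubicBracket (N := N)) := by
  refine .of_apply ?_ fun x M hM hc q => cubicBracket_apply x hM hc q
  have ha := contDiff_al (N := N)
  have hb := contDiff_be (N := N)
  intro p q
  simp only [cubicBracket_eq]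
  refine contDiff_blockTensor (fun i j => ?_) (fun i j => ?_) (fun i j => ?_) p q <;>
    split_ifs <;> fun_prop

/-- By `sharp_lieDerivative`, `d Tr L ^ j` goes to `j [X, χ_{j+s-1}]` minus the image of `j d Tr L ^
(j+e-1)`, that is, to `j ((j+s-1) - (j+e-1)) χ_{j+s+e-2} = j (s-e) χ_{j+s+e-2}`. With `m = s + 1`
and `k = e - 1` the factor `s - e` is `m - k - 2`; indexing by `e` lets `X_{-1}` be the case `e =
0`. -/
theorem HasLenardRelations.lieDerivative {s e : ℕ} {π : Space N → Matrix (Index N) (Index N) ℝ}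
    {X : Space N → Space N} (h : HasLenardRelations (s + 1) π) (hX : IsMasterSymmetry e X)
    (hse : 1 ≤ s + e) {c : ℝ} (hc : c * ((s : ℝ) - e) = 1) :
    HasLenardRelations (s + e) (c • Toda.lieDerivative X π) := by
  refine ⟨hse, fun p q => (contDiff_lieDerivative hX.smooth h.smooth p q).const_smul c,
    fun j => ?_⟩
  have h1 : (fun y => fderiv ℝ (fun z : Space N => (lax z ^ j).trace) y (X y)) =
      fun y => (j : ℝ) * (lax y ^ (j + e - 1)).trace := funext fun y => hX.trace j y
  rw [sharp_smul_tensor, sharp_lieDerivative hX.smooth h.smooth (contDiff_trace_pow j), h1,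
    sharp_const_mul _ _ (contDiff_trace_pow _), h.sharp, h.sharp]
  funext x
  have h2 : VectorField.lieBracket ℝ X ((j : ℝ) • hamiltonianField (j + (s + 1) - 2)) x =
      (j : ℝ) • VectorField.lieBracket ℝ X (hamiltonianField (j + (s + 1) - 2)) x :=
    VectorField.lieBracket_const_smul_right
      ((contDiff_hamiltonianField _).differentiable (by simp) x)
  simp only [Pi.smul_apply, Pi.sub_apply]
  rw [h2, hX.bracket, Pi.smul_apply]
  rcases j with _ | j
  · simp
  · have e1 : j + 1 + (s + 1) - 2 = j + s := by omega
    have e2 : j + 1 + e - 1 = j + e := by omega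
    have e3 : j + e + (s + 1) - 2 = j + s + e - 1 := by omega
    have e4 : j + 1 + (s + e) - 2 = j + s + e - 1 := by omega
    rw [e1, e2, e3, e4]
    simp only [smul_smul, ← sub_smul]
    congr 1
    push_cast
    linear_combination ((j : ℝ) + 1) * hc

theorem IsTodaBracket.hasLenardRelations {n : ℕ} {π : Space N → Matrix (Index N) (Index N) ℝ}
    (h : IsTodaBracket n π) : HasLenardRelations n π := by
  induction h with
  | linear => exact hasLenardRelations_linear
  | quadratic => exact hasLenardRelations_quadratic
  | cubic => exact hasLenardRelations_cubic
  | @raise m π k hk _ ih =>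
    obtain ⟨s, rfl⟩ : ∃ s, m = s + 1 := ⟨m - 1, by have := ih.pos; omega⟩
    have hne : ((s + 1 : ℕ) : ℝ) - k - 2 ≠ 0 := by
      rw [sub_sub, sub_ne_zero]
      exact_mod_cast hk
    have h := ih.lieDerivative (isMasterSymmetry k) (by omega)
      (c := (((s + 1 : ℕ) : ℝ) - k - 2)⁻¹) (by
        rw [inv_mul_eq_one₀ hne]
        push_cast
        ring)
    rwa [add_right_comm, add_assoc]
  | @lower m π hm _ ih =>
    have hne : (m : ℝ) ≠ 0 := by
      rw [Nat.cast_ne_zero]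
      omega
    exact ih.lieDerivative (e := 0) isMasterSymmetry_translation hm (by
      rw [Nat.cast_zero, sub_zero, inv_mul_cancel₀ hne])
  | equiv _ hτ ih =>
    refine ⟨ih.pos, fun p q => (ih.smooth p q).add (hτ.smooth p q), fun j => ?_⟩
    rw [sharp_add_tensor, ih.sharp]
    -- The trace of `L ^ 0` is constant, so its differential vanishes; the other traces are
    -- multiples of the `H_j`, which are Casimirs of `τ`.
    rcases j with _ | j
    · funext x q
      simp [Toda.sharp, pderiv]
    · have h1 : (fun x : Space N => (lax x ^ (j + 1)).trace) =
          fun x => ((j + 1 : ℕ) : ℝ) * hamiltonian (j + 1) x := by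
        funext x
        rw [hamiltonian, mul_inv_cancel_left₀ (by positivity)]
      rw [h1, sharp_const_mul _ _ (f := hamiltonian (j + 1)) (contDiff_const.mul (contDiff_trace_pow _)),
        (hτ.casimir (j + 1) (by omega)).sharp_eq_zero, smul_zero, add_zero]

end Hierarchy

/-! ### Negative powers of the Lax matrix -/

section NegativePowers

variable {N : ℕ}

theorem gradTrace_add (M W : Matrix (Fin N) (Fin N) ℝ) (p : Index N) :
    gradTrace (M + W) p = gradTrace M p + gradTrace W p := by
  rcases p with i | i <;> simp only [gradTrace, ent_add, mul_add]

theorem gradTrace_smul (c : ℝ) (M : Matrix (Fin N) (Fin N) ℝ) (p : Index N) :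
    gradTrace (c • M) p = c * gradTrace M p := by
  rcases p with i | i <;> simp only [gradTrace, ent_smul, mul_left_comm]

/-- With `x` fixed, both sides are linear in the matrix, and for `L ^ j` this is the relation for
`Tr L ^ (j+1)` divided by `j + 1`. It no longer refers to the derivative of any function, so inverse
powers may be inserted. -/
theorem HasLenardRelations.apply_aeval {s : ℕ} {π : Space N → Matrix (Index N) (Index N) ℝ}
    (h : HasLenardRelations (s + 1) π) (x : Space N) (P : Polynomial ℝ) (q : Index N) :
    ∑ p, π x p q * gradTrace (Polynomial.aeval (lax x) P) p =
      flow x (Polynomial.aeval (lax x) P * lax x ^ s) q := by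
  induction P using Polynomial.induction_on' with
  | add P P' hP hP' =>
    simp only [map_add, gradTrace_add, mul_add, Finset.sum_add_distrib, hP, hP', add_mul,
      Pi.add_apply]
  | monomial j c =>
    have h1 := congrFun (congrFun (h.sharp (j + 1)) x) q
    have hj : ((j + 1 : ℕ) : ℝ) ≠ 0 := by positivity
    have e1 : j + 1 + (s + 1) - 2 = j + s := by omega
    simp only [Toda.sharp, pderiv_trace_pow, mul_left_comm _ ((j + 1 : ℕ) : ℝ),
      ← Finset.mul_sum, Nat.add_sub_cancel, Pi.smul_apply, smul_eq_mul, e1] at h1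
    have h2 := mul_left_cancel₀ hj h1
    rw [Polynomial.aeval_monomial, ← Algebra.smul_def, Matrix.smul_mul, map_smul,
      ← pow_add, Pi.smul_apply, smul_eq_mul, ← hamiltonianField, ← h2, Finset.mul_sum]
    refine Finset.sum_congr rfl fun p _ => ?_
    rw [gradTrace_smul]
    ring

/-- Cayley-Hamilton: write the characteristic polynomial as `X · divX + c`, where `c = ± det A ≠ 0`,
and solve for the inverse. -/
theorem exists_aeval_eq_inv {A : Matrix (Fin N) (Fin N) ℝ} (hA : A.det ≠ 0) :
    ∃ P : Polynomial ℝ, Polynomial.aeval A P = A⁻¹ := by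
  set χ := A.charpoly
  have h0 : χ.coeff 0 ≠ 0 := fun h => hA (by rw [Matrix.det_eq_sign_charpoly_coeff, h, mul_zero])
  have h1 : A * Polynomial.aeval A χ.divX + (χ.coeff 0) • (1 : Matrix (Fin N) (Fin N) ℝ) = 0 := by
    have h := Matrix.aeval_self_charpoly A
    rw [← Polynomial.X_mul_divX_add A.charpoly, map_add, map_mul, Polynomial.aeval_X,
      Polynomial.aeval_C, Algebra.algebraMap_eq_smul_one] at h
    exact h
  refine ⟨(-(χ.coeff 0)⁻¹) • χ.divX, (Matrix.inv_eq_right_inv ?_).symm⟩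
  rw [map_smul, Matrix.mul_smul, eq_neg_of_add_eq_zero_left h1, smul_neg, neg_smul, neg_neg,
    smul_smul, inv_mul_cancel₀ h0, one_smul]

-- Inverse powers on the set `det L ≠ 0`

attribute [local instance] Matrix.linftyOpNormedRing Matrix.linftyOpNormedAlgebra

theorem contDiffAt_inv_lax_pow {x : Space N} (hx : (lax x).det ≠ 0) (t : ℕ) :
    ContDiffAt ℝ ∞ (fun y : Space N => (lax y ^ t)⁻¹) x := by
  have hu : IsUnit (lax x ^ t) :=
    ((Matrix.isUnit_iff_isUnit_det _).2 (isUnit_iff_ne_zero.2 hx)).pow t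
  obtain ⟨u, hu⟩ := hu
  simp only [Matrix.nonsing_inv_eq_ringInverse]
  have h1 : ContDiffAt ℝ ∞ Ring.inverse (lax x ^ t) := by
    rw [← hu]
    exact contDiffAt_ringInverse ℝ u
  exact h1.comp x (contDiff_lax_pow t).contDiffAt

theorem contDiffAt_trace_inv_lax_pow {x : Space N} (hx : (lax x).det ≠ 0) (t : ℕ) :
    ContDiffAt ℝ ∞ (fun y : Space N => ((lax y ^ t)⁻¹).trace) x :=
  (traceCLM N).contDiff.contDiffAt.comp x (contDiffAt_inv_lax_pow hx t)

theorem isOpen_det_lax_ne_zero : IsOpen {x : Space N | (lax x).det ≠ 0} :=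
  isOpen_ne_fun (contDiff_lax.continuous.matrix_det) continuous_const

/-- Moving along `X_{-1}` replaces `L` by `L + t`, whose determinant is a monic polynomial in `t`
with finitely many roots. -/
theorem dense_det_lax_ne_zero : Dense {x : Space N | (lax x).det ≠ 0} := by
  intro x
  have hd : ∀ t : ℝ, (lax (x + t • translationField x)).det = (-lax x).charpoly.eval t := by
    intro t
    rw [Matrix.eval_charpoly, lax_add, lax_smul, lax_translationField, sub_neg_eq_add, add_comm, Matrix.scalar_apply,
      Matrix.smul_one_eq_diagonal]
  have hfin : {t : ℝ | (-lax x).charpoly.IsRoot t}.Finite :=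
    Polynomial.finite_setOfPred_isRoot (Matrix.charpoly_monic _).ne_zero
  have hdense : Dense {t : ℝ | (-lax x).charpoly.IsRoot t}ᶜ := hfin.countable.dense_compl ℝ
  have hcont : Continuous fun t : ℝ => x + t • translationField x := by fun_prop
  have h := map_mem_closure hcont (hdense 0) (t := {x : Space N | (lax x).det ≠ 0})
    fun t ht' => by
      simp only [Set.mem_ofPred_eq, hd]
      exact ht'
  simpa using h

/-- Differentiating `L ^ (-r) L ^ r = 1` gives `d(L ^ (-r)) = -L ^ (-r) d(L ^ r) L ^ (-r)`. Under
the trace the two outer factors merge into `K = L ^ (-2r)`, which commutes with `L`, so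
`trace_mul_fderiv_lax_pow` leaves `-r Tr(L ^ (-r-1) dL)`; here `r = t + 1`. -/
theorem pderiv_trace_inv_lax_pow {x : Space N} (hx : (lax x).det ≠ 0) (t : ℕ) (p : Index N) :
    pderiv p (fun y : Space N => ((lax y ^ (t + 1))⁻¹).trace) x =
      -((t : ℝ) + 1) * gradTrace ((lax x)⁻¹ ^ (t + 2)) p := by
  set v : Space N := Pi.single p 1
  set L := lax x with hL
  have hdet : IsUnit L.det := isUnit_iff_ne_zero.2 hx
  have dI := (contDiffAt_inv_lax_pow hx (t + 1)).differentiableAt (by simp)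
  have dM := differentiableAt_lax_pow (N := N) (t + 1) x
  have hprod : (fun y : Space N => (lax y ^ (t + 1))⁻¹ * lax y ^ (t + 1)) =ᶠ[nhds x]
      fun _ => 1 := by
    filter_upwards [isOpen_det_lax_ne_zero.mem_nhds hx] with y hy
    refine Matrix.nonsing_inv_mul _ ?_
    rw [Matrix.det_pow]
    exact (isUnit_iff_ne_zero.2 hy).pow _
  have h0 : fderiv ℝ (fun y : Space N => (lax y ^ (t + 1))⁻¹ * lax y ^ (t + 1)) x v = 0 := by
    rw [hprod.fderiv_eq]
    simp
  rw [fderiv_matrix_mul dI dM] at h0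
  have hLI : L * L⁻¹ = 1 := Matrix.mul_nonsing_inv _ hdet
  have hIL : L⁻¹ * L = 1 := Matrix.nonsing_inv_mul _ hdet
  have hc : Commute L L⁻¹ := hLI.trans hIL.symm
  have hI : ∀ k : ℕ, L ^ k * L⁻¹ ^ k = 1 := fun k => by rw [← hc.mul_pow, hLI, one_pow]
  have hinv : (L ^ (t + 1))⁻¹ = L⁻¹ ^ (t + 1) := (Matrix.inv_pow' _ _).symm
  have h1 : fderiv ℝ (fun y : Space N => (lax y ^ (t + 1))⁻¹) x v =
      -(L⁻¹ ^ (t + 1) * fderiv ℝ (fun y => lax y ^ (t + 1)) x v * L⁻¹ ^ (t + 1)) := by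
    have h2 := congrArg (· * L⁻¹ ^ (t + 1)) (eq_neg_of_add_eq_zero_right h0)
    simp only [mul_assoc, neg_mul] at h2
    rw [hI, mul_one, hinv] at h2
    rw [h2, mul_assoc]
  have h2 : HasFDerivAt (fun y : Space N => ((lax y ^ (t + 1))⁻¹).trace)
      ((traceCLM N).comp (fderiv ℝ (fun y : Space N => (lax y ^ (t + 1))⁻¹) x)) x :=
    (traceCLM N).hasFDerivAt.comp x dI.hasFDerivAt
  have h3 : pderiv p (fun y : Space N => ((lax y ^ (t + 1))⁻¹).trace) x =
      (fderiv ℝ (fun y : Space N => (lax y ^ (t + 1))⁻¹) x v).trace := by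
    rw [pderiv, h2.fderiv]
    rfl
  have h4 : Commute (L⁻¹ ^ (t + 1) * L⁻¹ ^ (t + 1)) L :=
    Commute.mul_left (hc.symm.pow_left _) (hc.symm.pow_left _)
  have h5 : L⁻¹ ^ (t + 1) * L⁻¹ ^ (t + 1) * L ^ (t + 1 - 1) = L⁻¹ ^ (t + 2) := by
    rw [Nat.add_sub_cancel, ← pow_add, show t + 1 + (t + 1) = t + 2 + t by ring, pow_add,
      mul_assoc, ← hc.symm.mul_pow, hIL, one_pow, mul_one]
  have hs : (L⁻¹ ^ (t + 2)).IsSymm := by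
    rw [Matrix.IsSymm, Matrix.transpose_pow, Matrix.transpose_nonsing_inv, (lax_isSymm x).eq]
  rw [h3, h1, Matrix.trace_neg, Matrix.trace_mul_comm, ← mul_assoc,
    trace_mul_fderiv_lax_pow h4, ← hL, h5, trace_mul_lax_single hs]
  push_cast
  ring

theorem IsTodaBracket.isCasimirOn {n : ℕ} (hn : 2 < n)
    {π : Space N → Matrix (Index N) (Index N) ℝ} (hπ : IsTodaBracket n π) :
    IsCasimirOn π {x : Space N | (lax x).det ≠ 0} fun x => (lax x ^ (2 - (n : ℤ))).trace := by
  obtain ⟨t, rfl⟩ : ∃ t, n = t + 2 + 1 := ⟨n - 3, by omega⟩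
  have hz : (fun x : Space N => (lax x ^ (2 - ((t + 2 + 1 : ℕ) : ℤ))).trace) =
      fun x => ((lax x ^ (t + 1))⁻¹).trace := by
    funext x
    rw [← Matrix.zpow_neg_natCast, show (2 - ((t + 2 + 1 : ℕ) : ℤ)) = -((t + 1 : ℕ) : ℤ) by
      push_cast; ring]
  rw [hz]
  refine ⟨fun x hx => (contDiffAt_trace_inv_lax_pow hx _).contDiffWithinAt, fun g _ x hx => ?_⟩
  have h := hπ.hasLenardRelations
  obtain ⟨P, hP⟩ := exists_aeval_eq_inv hx
  have hLI : lax x * (lax x)⁻¹ = 1 := Matrix.mul_nonsing_inv _ (isUnit_iff_ne_zero.2 hx)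
  have hIL : (lax x)⁻¹ * lax x = 1 := Matrix.nonsing_inv_mul _ (isUnit_iff_ne_zero.2 hx)
  have hc : Commute (lax x)⁻¹ (lax x) := hIL.trans hLI.symm
  rw [bracket_eq_sum_sharp]
  refine Finset.sum_eq_zero fun q _ => ?_
  -- With `n = t + 3` the differential involves `L ^ (-(t+2))`, and the relation multiplies it by `L
  -- ^ (n-1) = L ^ (t+2)`, which gives the identity matrix.
  have h1 := h.apply_aeval x (P ^ (t + 2)) q
  rw [map_pow, hP, ← hc.mul_pow, hIL, one_pow, flow_one, Pi.zero_apply] at h1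
  simp only [sharp, pderiv_trace_inv_lax_pow hx, mul_left_comm _ (-((t : ℝ) + 1)),
    ← Finset.mul_sum, h1, mul_zero, zero_mul]

end NegativePowers

end Toda

end

theorem proposition5 (N : ℕ) (hN : 1 ≤ N) (n : ℕ) (hn : 2 < n)
    (π : Toda.Space N → Matrix (Toda.Index N) (Toda.Index N) ℝ)
    (hπ : Toda.IsTodaBracket n π) :
    IsOpen {x : Toda.Space N | (Toda.lax x).det ≠ 0} ∧
    Dense {x : Toda.Space N | (Toda.lax x).det ≠ 0} ∧
    Toda.IsCasimirOn π {x : Toda.Space N | (Toda.lax x).det ≠ 0}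
      (fun x => (Toda.lax x ^ (2 - (n : ℤ))).trace) :=
  ⟨Toda.isOpen_det_lax_ne_zero, Toda.dense_det_lax_ne_zero, hπ.isCasimirOn hn⟩
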